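/- **Conventions.** $\log x$ stands for $\max\{1,\log_2 x\}$, and $\Omega\subset[0,\pi/2]$ is a set of directions. *Directions.* A sequence $(\omega_n)$ of positive reals is *lacunary* if, for some $A<1$, $\omega_{n+1}/\omega_n<A$ for all $n$. *Lacunary sets of order $M\ge 1$* are defined inductively. A set of order $1$ is one contained in a lacunary sequence. A set $\Omega$ is of order $M+1$ if there are a set $\Omega'$ of order $M$, a number $A<1$ and, for each $a\in\Omega'$, two sequences $a+r_a(n)$ and $a-l_a(n)$ converging to $a$, where $r_a(n),l_a(n)>0$ and $r_a(n+1)/r_a(n)<A$, $l_a(n+1)/l_a(n)<A$ for all $n$, such that every $x\in\Omega$ either lies in $\Omega'$ or is a term of one of the two sequences belonging to some $a\in\Omega'$ with no point of $\Omega'$ strictly between $a$ and $x$. The *upper Minkowski dimension* of $\Omega$ is the infimum of all $s\ge 0$ such that, for all sufficiently small $\delta>0$, $\Omega$ can be covered by $O(\delta^{-s})$ intervals of length $\delta$. *Good angles.* Put $\Omega^*=\Omega\cup\{0\}\cup(\Omega+\frac{\pi}{2})\cup\{\frac{\pi}{2}\}$. For $g:\mathbb N\to(0,\infty)$, a real number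 $\alpha$ is called *$g$-good for $\Omega$* if there is $c>0$ such that for all $\theta\in\Omega^*$, $p\in\mathbb Z$, $q\in\mathbb N$ (in particular all the tangents are defined) $$\Big|\tan(\alpha-\theta)-\frac pq\Big|>c\,g(q).$$ *Rectangles.* For $N\in\mathbb N$ let $V$ be the square $[0,N^{1/2})^2$ rotated about the origin by $\alpha$ (counterclockwise; the same is asserted for the clockwise rotation). Let $\mathcal A_{\Omega,\alpha}$ be the family of all rectangles $R\subset V$ (nondegenerate, containing any part of their boundary) that have a side which is either parallel to a side of $V$ or makes the angle $\theta-\alpha$ with the $x$-axis for some $\theta\in\Omega$. Put $D(R)=\#(\mathbb Z^2\cap R)-|R|$. **Lemma.** 1. Let $\Omega\subset[0,\pi/2]$ be a lacunary sequence and $g(q)=\dfrac1{q^2\log^2 q}$. Then a $g$-good $\alpha\in[0,\pi/2]$ exists, and for every $g$-good $\alpha\in\mathbb R$ there is a constant $C$ such that $|D(R)|\le C\log^3 N$ for all $N\ge1$ and all $R\in\mathcal A_{\Omega,\alpha}$. 2. Let $\Omega\subset[0,\pi/2]$ be a lacunary set of order $M\ge1$ and $g(q)=\dfrac1{q^2\log^{2M}q}$.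 Then a $g$-good $\alpha\in[0,\pi/2]$ exists, and for every $g$-good $\alpha\in\mathbb R$ there is a constant $C$ such that $|D(R)|\le C\log^{2M+1} N$ for all $N\ge1$ and all $R\in\mathcal A_{\Omega,\alpha}$. 3. Let $\Omega\subset[0,\pi/2]$ have upper Minkowski dimension $d$ with $0\le d<1$, let $\tau=\frac{2}{(1-d)^2}-2$, $\varepsilon>0$ and $g(q)=q^{-\frac{2}{(1-d)^2}-\varepsilon}$. Then a $g$-good $\alpha\in[0,\pi/2]$ exists, and for every $g$-good $\alpha\in\mathbb R$ there is a constant $C$ such that $|D(R)|\le C N^{\frac{\tau}{2(\tau+1)}+\varepsilon}$ for all $N\ge1$ and all $R\in\mathcal A_{\Omega,\alpha}$. -/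

import Mathlib

namespace DirDisc

/-- The logarithm convention `log x = max {1, log₂ x}`. -/
noncomputable def clog (x : ℝ) : ℝ := max 1 (Real.logb 2 x)

/-! ### Sets of directions -/

/-- A sequence of positive reals whose consecutive ratios are all smaller than `A`.
It is lacunary when `A < 1`. -/
def LacunaryWith (A : ℝ) (ω : ℕ → ℝ) : Prop :=
  ∀ n, 0 < ω n ∧ ω (n + 1) / ω n < A

/-- Lacunary sequences. -/
def IsLacunarySeq (ω : ℕ → ℝ) : Prop := ∃ A < 1, LacunaryWith A ω

/-- Lacunary sets of order `M ≥ 1`.  A set of order one is (contained in) a lacunary sequence.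
A set of order `M + 1` is covered by a set `Ω'` of order `M` together with lacunary sequences
`a + r a n` and `a - l a n` (as `n → ∞`) converging to the points `a` of `Ω'` from the right and
from the left.  All these sequences have a common ratio `A < 1`, and the sequence belonging to `a`
is used only in the gaps of `Ω'` next to `a`: no point of `Ω'` lies strictly between `a` and the
term `x` of the sequence. -/
inductive IsLacunaryOfOrder : ℕ → Set ℝ → Prop
  | one (Ω : Set ℝ) (ω : ℕ → ℝ) (hω : IsLacunarySeq ω) (hΩ : Ω ⊆ Set.range ω) :
      IsLacunaryOfOrder 1 Ω
  | succ (M : ℕ) (Ω Ω' : Set ℝ) (hΩ' : IsLacunaryOfOrder M Ω')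
      (A : ℝ) (hA : A < 1) (r l : ℝ → ℕ → ℝ)
      (hr : ∀ a ∈ Ω', LacunaryWith A (r a)) (hl : ∀ a ∈ Ω', LacunaryWith A (l a))
      (hcover : ∀ x ∈ Ω, x ∈ Ω' ∨
        ∃ a ∈ Ω', ((∃ n, x = a + r a n) ∨ (∃ n, x = a - l a n)) ∧
          ∀ b ∈ Ω', b ∉ Set.Ioo (min a x) (max a x)) :
      IsLacunaryOfOrder (M + 1) Ω

/-- `Ω` can be covered by `O(δ ^ (-s))` intervals of length `δ`, for all small `δ > 0`. -/
def CoveredWithExponent (Ω : Set ℝ) (s : ℝ) : Prop :=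
  ∃ C : ℝ, ∃ δ₀ > 0, ∀ δ : ℝ, 0 < δ → δ < δ₀ →
    ∃ F : Finset ℝ, (F.card : ℝ) ≤ C * δ ^ (-s) ∧ Ω ⊆ ⋃ x ∈ F, Set.Icc x (x + δ)

/-- Upper Minkowski dimension of a bounded subset of the line (every exponent `s ≥ 1` is
admissible for a bounded set, so the infimum is over a nonempty set of nonnegative reals). -/
noncomputable def upperMinkowskiDim (Ω : Set ℝ) : ℝ :=
  sInf {s : ℝ | 0 ≤ s ∧ CoveredWithExponent Ω s}

/-! ### Good angles -/

/-- The set `Ω ∪ {0} ∪ (Ω + π/2) ∪ {π/2}`. -/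
noncomputable def enlarge (Ω : Set ℝ) : Set ℝ :=
  Ω ∪ {0} ∪ (fun θ => θ + Real.pi / 2) '' Ω ∪ {Real.pi / 2}

/-- `|tan (α - θ) - p / q| > c * g q` for all `θ` in the enlarged set, `p ∈ ℤ` and `q ≥ 1`, with a
single `c > 0`.  (If the tangent is undefined, `Real.tan` is `0` and the inequality fails for
`p = 0` when `g ≥ 0`, so a good angle has all these tangents defined.) -/
def IsGoodAngle (Ω : Set ℝ) (g : ℕ → ℝ) (α : ℝ) : Prop :=
  ∃ c > 0, ∀ θ ∈ enlarge Ω, ∀ p : ℤ, ∀ q : ℕ, 1 ≤ q →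
    c * g q < |Real.tan (α - θ) - (p : ℝ) / (q : ℝ)|

/-! ### Rectangles and lattice discrepancy -/

/-- Counterclockwise rotation of the plane by `φ` about the origin. -/
noncomputable def rot (φ : ℝ) (z : ℝ × ℝ) : ℝ × ℝ :=
  (Real.cos φ * z.1 - Real.sin φ * z.2, Real.sin φ * z.1 + Real.cos φ * z.2)

/-- The square `[0, √N)²` rotated counterclockwise by `β`. -/
noncomputable def rotSquare (N : ℕ) (β : ℝ) : Set (ℝ × ℝ) :=
  rot β '' (Set.Ico 0 (Real.sqrt N) ×ˢ Set.Ico 0 (Real.sqrt N))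

/-- `R` is a (nondegenerate) rectangle with a side in the direction that makes the angle `φ` with
the `x`-axis; any part of the boundary may belong to `R`. -/
def IsRectangle (φ : ℝ) (R : Set (ℝ × ℝ)) : Prop :=
  ∃ (c : ℝ × ℝ) (a b : ℝ), 0 < a ∧ 0 < b ∧
    (fun z => c + rot φ z) '' (Set.Ioo 0 a ×ˢ Set.Ioo 0 b) ⊆ R ∧
    R ⊆ (fun z => c + rot φ z) '' (Set.Icc 0 a ×ˢ Set.Icc 0 b)

/-- The rectangles contained in the square `V = rotSquare N β` that have a side which is parallel
to a side of `V` or makes the angle `θ - α` with the `x`-axis for some `θ ∈ Ω`. -/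
def admissible (Ω : Set ℝ) (α β : ℝ) (N : ℕ) : Set (Set (ℝ × ℝ)) :=
  {R | R ⊆ rotSquare N β ∧ (IsRectangle β R ∨ ∃ θ ∈ Ω, IsRectangle (θ - α) R)}

/-- Lattice discrepancy `#(ℤ² ∩ R) - |R|`. -/
noncomputable def latticeDisc (R : Set (ℝ × ℝ)) : ℝ :=
  (Set.ncard {n : ℤ × ℤ | ((n.1 : ℝ), (n.2 : ℝ)) ∈ R} : ℝ) - (MeasureTheory.volume R).toReal

/-- With one constant `C`, `|#(ℤ² ∩ R) - |R|| ≤ C * F N` for every `N ≥ 1` and every admissible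
rectangle `R`, the square `V` being rotated by `α` counterclockwise (`β = α`) or clockwise
(`β = -α`). -/
def DiscBound (Ω : Set ℝ) (α : ℝ) (F : ℕ → ℝ) : Prop :=
  ∃ C : ℝ, ∀ N : ℕ, 1 ≤ N → ∀ β : ℝ, (β = α ∨ β = -α) →
    ∀ R ∈ admissible Ω α β N, |latticeDisc R| ≤ C * F N

end DirDisc

open DirDisc

/-! Discrepancy. Cut a tilted rectangle by the lines x = m. The chord lengths are combinations of
hinge functions of m, and their sum is the area up to a bounded multiple of tan + cot of the tilt
(`abs_sum_hinge_sub_le`). Rounding the end points of the chords leaves sawtooth sums along the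
slopes ±t, ±1/t of the sides (`abs_latticeDisc_le_of_pos`). If p/q with q ≤ H is the Dirichlet
approximation of a slope, a block of q consecutive terms runs through all residues mod q and
contributes O(1) (`abs_sum_saw_block_le`). So H terms cost O(H/q) plus a remainder at most half as
long, and about log H rounds finish the sum (`abs_sum_saw_le`). Goodness keeps q from being much
smaller than H: c g(q) < 1/((H+1)q) is turned into H ≤ q E(H), and the discrepancy is O(E(H) log H +
1) with H of order √N (`discBound_of_isGoodAngle`).

Existence. A good angle is a common point of nested intervals of lengths L_{k+1} = φ(L_k)
(`exists_isGoodAngle`). Cover the enlarged set of directions by n cells of length φ(L), where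
12(n+1)φ(L) ≤ L. While α runs over an interval of length L_k and θ over one cell, tan(α - θ) moves
by O(L_k), so at most one fraction with q² L_k < c₀ is dangerous. The bad α of a cell then lie
within 5 L_{k+1} of each other, and the pigeonhole principle leaves a free subinterval of length
L_{k+1}. A denominator q is handled at the first k with q² L_k < c₀, and there L_{k+1} ≥
φ(φ(c₀/q²)). Thus g is governed by the second iterate of φ. Coverings by O(log^M (1/δ)) intervals
(`IsLacunaryOfOrder.exists_coveredBy`) permit φ(L) of order L / log^M (1/L), whence the power 2M;
dimension below s permits φ(L) of order L^(1/(1-s)), whence the power 2/(1-s)². -/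

namespace DirDisc
open Finset

/-! ### Sawtooth sums along arithmetic progressions. -/

/-- The centred sawtooth function. -/
noncomputable def saw (x : ℝ) : ℝ := Int.fract x - 1 / 2

/-- Since p is invertible mod q, the map n ↦ np + k permutes the residues. -/
lemma sum_range_mul_add_emod {q : ℕ} (hq : 0 < q) {p : ℤ} (hp : IsCoprime p (q : ℤ)) (k : ℤ)
    (f : ℤ → ℝ) :
    ∑ n ∈ range q, f (((n : ℤ) * p + k) % q) = ∑ n ∈ range q, f n := by
  have hq' : (0 : ℤ) < q := by exact_mod_cast hq
  have hmaps : ∀ n ∈ range q, (((n : ℤ) * p + k) % q).toNat ∈ range q := by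
    intro n _
    have h1 := Int.emod_nonneg ((n : ℤ) * p + k) hq'.ne'
    have h2 := Int.emod_lt_of_pos ((n : ℤ) * p + k) hq'
    rw [mem_range]; omega
  have hinj : Set.InjOn (fun n : ℕ => (((n : ℤ) * p + k) % q).toNat) (range q) := by
    intro n hn m hm h
    have h1 := Int.emod_nonneg ((n : ℤ) * p + k) hq'.ne'
    have h2 := Int.emod_nonneg ((m : ℤ) * p + k) hq'.ne'
    have h3 : ((n : ℤ) * p + k) % q = ((m : ℤ) * p + k) % q := by
      simp only at h; omega
    have h4 : (q : ℤ) ∣ ((n : ℤ) * p + k) - ((m : ℤ) * p + k) :=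
      Int.ModEq.dvd (Int.ModEq.symm h3)
    have h5 : (q : ℤ) ∣ ((n : ℤ) - m) * p := by
      convert h4 using 1; ring
    have h6 : (q : ℤ) ∣ (n : ℤ) - m := hp.symm.dvd_of_dvd_mul_right h5
    simp only [coe_range, Set.mem_Iio] at hn hm
    have h7 : |(n : ℤ) - m| < q := by rw [abs_lt]; omega
    have := Int.eq_zero_of_abs_lt_dvd h6 h7
    omega
  refine sum_nbij (fun n : ℕ => (((n : ℤ) * p + k) % q).toNat) hmaps hinj
    (surjOn_of_injOn_of_card_le _ hmaps hinj le_rfl) ?_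
  intro n _
  rw [Int.toNat_of_nonneg (Int.emod_nonneg _ hq'.ne')]

/-- Up to an integer, βn + γ is r/q + e, where r runs once through the residues mod q and -1/q ≤ e <
2/q. The exact values r/q - 1/2 sum to -1/2, and the errors e add up to O(1). -/
lemma abs_sum_saw_block_le {q : ℕ} (hq : 0 < q) {p : ℤ} (hp : IsCoprime p (q : ℤ)) {β : ℝ}
    (hβ : |β - p / q| ≤ 1 / (q : ℝ) ^ 2) (γ : ℝ) :
    |∑ n ∈ range q, saw (β * n + γ)| ≤ 5 := by
  have hq' : (0 : ℝ) < q := by exact_mod_cast hq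
  have hqz : (0 : ℤ) < q := by exact_mod_cast hq
  set k : ℤ := ⌊(q : ℝ) * γ⌋ with hk
  -- Adding e to r/q can cross an integer only for r = 0 or r = q - 1; there the trivial error bound
  -- 1 is used.
  set G : ℤ → ℝ := fun r => 2 / q + ((if r = 0 then 1 else 0) + (if r = q - 1 then 1 else 0))
    with hG
  have key : ∀ n ∈ range q, |saw (β * n + γ) - (((((n : ℤ) * p + k) % q : ℤ) : ℝ) / q - 1 / 2)| ≤
      G (((n : ℤ) * p + k) % q) := by
    intro n hn
    have hn' : (n : ℝ) < q := by exact_mod_cast mem_range.1 hn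
    set r : ℤ := ((n : ℤ) * p + k) % q with hr
    set e : ℝ := n * (β - p / q) + Int.fract ((q : ℝ) * γ) / q with he
    have hr0 : 0 ≤ r := Int.emod_nonneg _ hqz.ne'
    have hrq : r < q := Int.emod_lt_of_pos _ hqz
    have hr0' : (0 : ℝ) ≤ r := by exact_mod_cast hr0
    have hrq' : (r : ℝ) + 1 ≤ q := by exact_mod_cast hrq
    have hdecomp : β * n + γ = (r / q + e) + (((n : ℤ) * p + k) / q : ℤ) := by
      have h1 : (((n : ℤ) * p + k : ℤ) : ℝ) = r + q * (((n : ℤ) * p + k) / q : ℤ) := by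
        exact_mod_cast (Int.emod_add_mul_ediv ((n : ℤ) * p + k) q).symm
      have h2 : (q : ℝ) * γ = k + Int.fract ((q : ℝ) * γ) := (Int.floor_add_fract _).symm
      push_cast at h1
      have h3 : (q : ℝ) * (β * n + γ) = q * ((r / q + e) + (((n : ℤ) * p + k) / q : ℤ)) := by
        have : (q : ℝ) * ((r / q + e) + (((n : ℤ) * p + k) / q : ℤ)) =
            r + q * n * β - n * p + Int.fract ((q : ℝ) * γ) + q * (((n : ℤ) * p + k) / q : ℤ) := by
          rw [he]; field_simp; ring
        rw [this]; linarith
      exact mul_left_cancel₀ hq'.ne' h3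
    have hf0 := Int.fract_nonneg ((q : ℝ) * γ)
    have hf1 := Int.fract_lt_one ((q : ℝ) * γ)
    have hnb : |n * (β - p / q)| ≤ 1 / q := by
      rw [abs_mul, Nat.abs_cast]
      calc (n : ℝ) * |β - p / q| ≤ q * (1 / (q : ℝ) ^ 2) := by gcongr
        _ = 1 / q := by field_simp
    rw [abs_le] at hnb
    have hfq0 : 0 ≤ Int.fract ((q : ℝ) * γ) / q := by positivity
    have hfq1 : Int.fract ((q : ℝ) * γ) / q < 1 / q := by gcongr
    have he1 : -(1 / q) ≤ e := by rw [he]; linarith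
    have he2 : e < 2 / q := by
      have : (2 : ℝ) / q = 1 / q + 1 / q := by ring
      rw [he]; linarith
    have hfr : Int.fract (β * n + γ) = Int.fract (r / q + e) := by
      rw [hdecomp, Int.fract_add_intCast]
    have hsaw : saw (β * n + γ) - ((r : ℝ) / q - 1 / 2) = Int.fract (r / q + e) - r / q := by
      rw [saw, hfr]; ring
    rw [hsaw]
    have h2q : (0 : ℝ) < 2 / q := by positivity
    by_cases hexc : r = 0 ∨ r = q - 1
    · have hG1 : 1 ≤ G r := by
        rw [hG]; simp only
        rcases hexc with h | h
        · rw [if_pos h]; split_ifs <;> linarith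
        · rw [if_pos h]; split_ifs <;> linarith
      have h1 : (0 : ℝ) ≤ r / q := by positivity
      have h2 : (r : ℝ) / q < 1 := by rw [div_lt_one hq']; linarith
      have h3 := Int.fract_nonneg ((r : ℝ) / q + e)
      have h4 := Int.fract_lt_one ((r : ℝ) / q + e)
      refine le_trans ?_ hG1
      rw [abs_le]; constructor <;> linarith
    · push Not at hexc
      have h1 : (1 : ℝ) ≤ r := by
        have : 1 ≤ r := by omega
        exact_mod_cast this
      have h2 : (r : ℝ) + 2 ≤ q := by
        have : r + 2 ≤ q := by omega
        exact_mod_cast this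
      have h3 : Int.fract ((r : ℝ) / q + e) = r / q + e := by
        rw [Int.fract_eq_self]
        have h4 : 1 / (q : ℝ) ≤ r / q := by gcongr
        have h5 : (r : ℝ) / q + 2 / q ≤ 1 := by rw [← add_div, div_le_one hq']; exact h2
        constructor <;> linarith
      rw [h3, hG]
      simp only [if_neg hexc.1, if_neg hexc.2]
      rw [abs_le]
      have : (2 : ℝ) / q = 1 / q + 1 / q := by ring
      have : (0 : ℝ) < 1 / q := by positivity
      constructor <;> linarith
  have hsumr : ∑ n ∈ range q, (((((n : ℤ) * p + k) % q : ℤ) : ℝ) / q - 1 / 2) = -1 / 2 := by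
    rw [sum_range_mul_add_emod hq hp k (fun r => (r : ℝ) / q - 1 / 2), sum_sub_distrib,
      ← sum_div]
    have h1 : (∑ n ∈ range q, (((n : ℕ) : ℤ) : ℝ)) * 2 = q * (q - 1) := by
      have := Finset.sum_range_id_mul_two q
      have h2 : ((∑ n ∈ range q, n : ℕ) : ℝ) * 2 = q * ((q - 1 : ℕ) : ℝ) := by exact_mod_cast this
      rw [Nat.cast_sub hq] at h2
      push_cast at h2 ⊢
      exact h2
    have h2 : (∑ n ∈ range q, (((n : ℕ) : ℤ) : ℝ)) = q * (q - 1) / 2 := by linarith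
    rw [h2]
    simp
    field_simp
    ring
  have hsumG : ∑ n ∈ range q, G (((n : ℤ) * p + k) % q) ≤ 4 := by
    rw [sum_range_mul_add_emod hq hp k G, hG, sum_add_distrib, sum_add_distrib]
    have h1 : ∑ n ∈ range q, (if ((n : ℕ) : ℤ) = 0 then (1 : ℝ) else 0) ≤ 1 := by
      rw [← Nat.cast_one, ← Nat.cast_zero]
      simp only [Int.natCast_eq_zero, Nat.cast_zero]
      simp [hq]
    have h2 : ∑ n ∈ range q, (if ((n : ℕ) : ℤ) = q - 1 then (1 : ℝ) else 0) ≤ 1 := by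
      have : ∀ n : ℕ, ((n : ℤ) = q - 1) ↔ n = q - 1 := by intro n; omega
      simp only [this]
      simp [hq]
    have h3 : ∑ n ∈ range q, (2 : ℝ) / q = 2 := by
      simp; field_simp
    rw [h3]; linarith
  have habs : |∑ n ∈ range q, (saw (β * n + γ) -
      (((((n : ℤ) * p + k) % q : ℤ) : ℝ) / q - 1 / 2))| ≤ 4 :=
    (abs_sum_le_sum_abs _ _).trans ((sum_le_sum key).trans hsumG)
  rw [sum_sub_distrib, hsumr] at habs
  rw [abs_le] at habs ⊢
  constructor <;> linarith

/-- Sawtooth sums along a progression whose step has a good rational approximation with large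
denominator at every scale. -/
lemma abs_sum_saw_le {β : ℝ} {E : ℕ → ℝ} (hE : Monotone E) (hE0 : ∀ H, 0 ≤ E H)
    (hβ : ∀ H : ℕ, 1 ≤ H → ∃ r : ℚ, r.den ≤ H ∧ |β - r| ≤ 1 / (((H : ℝ) + 1) * r.den) ∧
      (H : ℝ) ≤ r.den * E H) (k : ℕ) :
    ∀ H : ℕ, H < 2 ^ k → ∀ γ : ℝ, |∑ n ∈ range H, saw (β * n + γ)| ≤ 5 * k * E H := by
  induction k with
  | zero =>
    intro H hH γ
    have : H = 0 := by simpa using hH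
    simp [this]
  | succ k ih =>
    intro H hH γ
    rcases Nat.eq_zero_or_pos H with rfl | hpos
    · simp only [range_zero, sum_empty, abs_zero]
      have := hE0 0
      positivity
    obtain ⟨r, hrH, hr, hHE⟩ := hβ H hpos
    set q := r.den with hq
    have hq0 : 0 < q := r.den_pos
    have hqR : (0 : ℝ) < q := by exact_mod_cast hq0
    have hcop : IsCoprime r.num (q : ℤ) := by
      rw [Int.isCoprime_iff_gcd_eq_one]
      exact r.reduced
    have hblock : ∀ γ, |∑ n ∈ range q, saw (β * n + γ)| ≤ 5 := by
      intro γ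
      refine abs_sum_saw_block_le hq0 hcop ?_ γ
      have h1 : ((r.num : ℝ) / (q : ℝ)) = r := by exact_mod_cast r.num_div_den
      rw [h1]
      refine hr.trans ?_
      have : (q : ℝ) ≤ H := by exact_mod_cast hrH
      rw [sq]
      gcongr
      linarith
    have hmul : ∀ m : ℕ, ∀ γ, |∑ n ∈ range (q * m), saw (β * n + γ)| ≤ 5 * m := by
      intro m
      induction m with
      | zero => intro γ; simp
      | succ m ihm =>
        intro γ
        rw [mul_add, mul_one, sum_range_add]
        refine (abs_add_le _ _).trans ?_
        have h1 := ihm γ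
        have h2 := hblock (β * (q * m : ℕ) + γ)
        have h3 : ∑ n ∈ range q, saw (β * ((q * m + n : ℕ) : ℝ) + γ) =
            ∑ n ∈ range q, saw (β * n + (β * (q * m : ℕ) + γ)) := by
          refine sum_congr rfl fun n _ => ?_
          congr 1; push_cast; ring
        rw [h3]
        push_cast at *
        linarith
    have hsplit : H = q * (H / q) + H % q := (Nat.div_add_mod H q).symm
    -- As q ≤ H, the remainder is at most half of H, so the dyadic induction hypothesis applies to
    -- it.
    have hmod : 2 * (H % q) ≤ H := by
      have h1 : H % q < q := Nat.mod_lt _ hq0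
      have h2 : q * 1 ≤ q * (H / q) := Nat.mul_le_mul_left _ (Nat.div_pos hrH hq0)
      omega
    have hlt : H % q < 2 ^ k := by rw [pow_succ] at hH; omega
    have h1 := hmul (H / q) γ
    have h2 := ih (H % q) hlt (β * (q * (H / q) : ℕ) + γ)
    have h3 : ∑ n ∈ range H, saw (β * n + γ) = ∑ n ∈ range (q * (H / q)), saw (β * n + γ) +
        ∑ n ∈ range (H % q), saw (β * n + (β * (q * (H / q) : ℕ) + γ)) := by
      conv_lhs => rw [hsplit]
      rw [sum_range_add]
      congr 1
      refine sum_congr rfl fun n _ => ?_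
      congr 1; push_cast; ring
    rw [h3]
    have h4 : ((H / q : ℕ) : ℝ) ≤ E H := by
      have : (q : ℝ) * (H / q : ℕ) ≤ q * E H := by
        refine le_trans ?_ hHE
        exact_mod_cast Nat.mul_div_le H q
      exact le_of_mul_le_mul_left this hqR
    have h5 : E (H % q) ≤ E H := hE (by omega)
    have h6 : 5 * (k : ℝ) * E (H % q) ≤ 5 * k * E H := by gcongr
    refine ((abs_add_le _ _).trans (add_le_add h1 h2)).trans ?_
    push_cast
    linarith

lemma abs_sum_Icc_saw_le {β : ℝ} {H : ℕ} {K : ℝ}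
    (h : ∀ n ≤ H, ∀ γ : ℝ, |∑ i ∈ range n, saw (β * i + γ)| ≤ K) {A B : ℤ} (hAB : B + 1 - A ≤ H)
    (γ : ℝ) : |∑ m ∈ Icc A B, saw (β * m + γ)| ≤ K := by
  have h1 : ∑ m ∈ Icc A B, saw (β * m + γ) =
      ∑ i ∈ range (B + 1 - A).toNat, saw (β * i + (β * A + γ)) := by
    rw [Int.Icc_eq_finset_map, sum_map]
    refine sum_congr rfl fun i _ => ?_
    congr 1
    simp
    ring
  rw [h1]
  exact h _ (by omega) _

/-- Meant for the upper and the lower boundary of a tilted rectangle, each of which is affine on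
either side of one corner. -/
lemma abs_sum_Icc_saw_piecewise_le {β₁ β₂ γ₁ γ₂ x : ℝ} {H : ℕ} {K : ℝ} {f : ℤ → ℝ}
    (h₁ : ∀ n ≤ H, ∀ γ : ℝ, |∑ i ∈ range n, saw (β₁ * i + γ)| ≤ K)
    (h₂ : ∀ n ≤ H, ∀ γ : ℝ, |∑ i ∈ range n, saw (β₂ * i + γ)| ≤ K)
    (hf₁ : ∀ m : ℤ, (m : ℝ) ≤ x → f m = β₁ * m + γ₁)
    (hf₂ : ∀ m : ℤ, x < m → f m = β₂ * m + γ₂)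
    {A B : ℤ} (hAB : B + 1 - A ≤ H) :
    |∑ m ∈ Icc A B, saw (f m)| ≤ 2 * K := by
  rw [← sum_filter_add_sum_filter_not (Icc A B) (fun m : ℤ => (m : ℝ) ≤ x)]
  have e1 : (Icc A B).filter (fun m : ℤ => (m : ℝ) ≤ x) = Icc A (min B ⌊x⌋) := by
    ext m; simp only [mem_filter, mem_Icc, le_min_iff, Int.le_floor]; tauto
  have e2 : (Icc A B).filter (fun m : ℤ => ¬ (m : ℝ) ≤ x) = Icc (max A (⌊x⌋ + 1)) B := by
    ext m; simp only [mem_filter, mem_Icc, max_le_iff, Int.add_one_le_iff, Int.floor_lt, not_le]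
    tauto
  rw [e1, e2]
  have s1 : ∑ m ∈ Icc A (min B ⌊x⌋), saw (f m) = ∑ m ∈ Icc A (min B ⌊x⌋), saw (β₁ * m + γ₁) := by
    refine sum_congr rfl fun m hm => ?_
    rw [hf₁ m (Int.le_floor.1 (le_min_iff.1 (mem_Icc.1 hm).2).2)]
  have s2 : ∑ m ∈ Icc (max A (⌊x⌋ + 1)) B, saw (f m) =
      ∑ m ∈ Icc (max A (⌊x⌋ + 1)) B, saw (β₂ * m + γ₂) := by
    refine sum_congr rfl fun m hm => ?_
    rw [hf₂ m (Int.floor_lt.1 (Int.add_one_le_iff.1 (max_le_iff.1 (mem_Icc.1 hm).1).2))]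
  rw [s1, s2]
  have t1 := abs_sum_Icc_saw_le h₁ (A := A) (B := min B ⌊x⌋) (by omega) γ₁
  have t2 := abs_sum_Icc_saw_le h₂ (A := max A (⌊x⌋ + 1)) (B := B) (by omega) γ₂
  refine (abs_add_le _ _).trans ?_
  linarith

/-- Raising B by one adds B + 1 - x to both sides, so the error does not depend on B. At B = ⌈x⌉ - 1
the sum is empty or zero and the polynomial is t(t - 1)/2 with t = ⌈x⌉ - x in [0, 1). -/
lemma abs_sum_hinge_sub_le {A B : ℤ} {x : ℝ} (hA : (A : ℝ) - 1 ≤ x) (hB : x ≤ B + 1) :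
    |∑ m ∈ Icc A B, max ((m : ℝ) - x) 0 - (B - x) * (B - x + 1) / 2| ≤ 1 / 8 := by
  have hB' : ⌈x⌉ - 1 ≤ B := by
    have : ⌈x⌉ ≤ B + 1 := Int.ceil_le.2 (by push_cast; exact hB)
    omega
  have hA' : A ≤ ⌈x⌉ + 1 := by
    have h1 : (A : ℝ) - 1 ≤ ⌈x⌉ := hA.trans (Int.le_ceil x)
    have : A - 1 ≤ ⌈x⌉ := by exact_mod_cast h1
    omega
  induction B, hB' using Int.leInduction with
  | base =>
    have h1 : ∑ m ∈ Icc A (⌈x⌉ - 1), max ((m : ℝ) - x) 0 = 0 := by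
      refine sum_eq_zero fun m hm => max_eq_right ?_
      have : m < ⌈x⌉ := by have := (mem_Icc.1 hm).2; omega
      have := Int.lt_ceil.1 this
      linarith
    rw [h1]
    have h2 := Int.le_ceil x
    have h3 := Int.ceil_lt_add_one x
    push_cast
    rw [abs_le]
    constructor <;> nlinarith [sq_nonneg ((⌈x⌉ : ℝ) - x - 1 / 2)]
  | succ B hB' ih =>
    have hxB : x ≤ B + 1 := by
      have : ⌈x⌉ ≤ B + 1 := by omega
      have := Int.ceil_le.1 this
      push_cast at this; exact this
    have ih' := ih hxB
    by_cases hAB : A ≤ B + 1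
    · have : Icc A (B + 1) = insert (B + 1) (Icc A B) := by
        ext m; simp only [mem_Icc, mem_insert]; omega
      rw [this, sum_insert (by simp)]
      push_cast
      rw [max_eq_left (by linarith)]
      convert ih' using 2
      ring
    · have hB2 : A = B + 2 := by omega
      have hx : x = B + 1 := by
        rw [hB2] at hA; push_cast at hA; linarith
      rw [Icc_eq_empty (by omega)]
      rw [hx]; push_cast; norm_num
end DirDisc

/-! ### Lattice points in one tilted rectangle. -/

namespace DirDisc
open Finset MeasureTheory

lemma rot_neg_rot (φ : ℝ) (z : ℝ × ℝ) : rot (-φ) (rot φ z) = z := by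
  have h := Real.sin_sq_add_cos_sq φ
  ext
  · simp only [rot, Real.cos_neg, Real.sin_neg]; linear_combination z.1 * h
  · simp only [rot, Real.cos_neg, Real.sin_neg]; linear_combination z.2 * h

lemma rot_rot_neg (φ : ℝ) (z : ℝ × ℝ) : rot φ (rot (-φ) z) = z := by
  simpa using rot_neg_rot (-φ) z

lemma mem_image_add_rot {φ : ℝ} {c w : ℝ × ℝ} {S : Set (ℝ × ℝ)} :
    w ∈ (fun z => c + rot φ z) '' S ↔ rot (-φ) (w - c) ∈ S := by
  constructor
  · rintro ⟨z, hz, rfl⟩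
    simpa [rot_neg_rot] using hz
  · intro h
    exact ⟨_, h, by simp [rot_rot_neg]⟩

lemma volume_image_add_rot (φ : ℝ) (c : ℝ × ℝ) (S : Set (ℝ × ℝ)) :
    volume ((fun z => c + rot φ z) '' S) = volume S := by
  set L := Matrix.toLin (Module.Basis.finTwoProd ℝ) (Module.Basis.finTwoProd ℝ)
    !![Real.cos φ, -Real.sin φ; Real.sin φ, Real.cos φ] with hL
  have h1 : (fun z => c + rot φ z) '' S = (fun w => c + w) '' (L '' S) := by
    rw [Set.image_image]
    refine Set.image_congr fun z _ => ?_
    rw [hL, Matrix.toLin_finTwoProd_apply]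
    simp only [rot]
    ring_nf
  have hdet : LinearMap.det L = 1 := by
    rw [hL, LinearMap.det_toLin, Matrix.det_fin_two_of]
    have := Real.sin_sq_add_cos_sq φ
    linear_combination this
  rw [h1, Set.image_add_left, measure_preimage_add, Measure.addHaar_image_linearMap, hdet]
  simp

lemma IsRectangle.add_pi_div_two {φ : ℝ} {R : Set (ℝ × ℝ)} (h : IsRectangle φ R) :
    IsRectangle (φ + Real.pi / 2) R := by
  obtain ⟨c, a, b, ha, hb, h1, h2⟩ := h
  refine ⟨c + rot φ (a, 0), b, a, hb, ha, ?_, ?_⟩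
  · rintro _ ⟨z, ⟨hz1, hz2⟩, rfl⟩
    refine h1 ⟨(a - z.2, z.1), ⟨⟨?_, ?_⟩, hz1⟩, ?_⟩
    · simp only [Set.mem_Ioo] at hz2 ⊢; linarith [hz2.2]
    · simp only [Set.mem_Ioo] at hz2 ⊢; linarith [hz2.1]
    · ext <;> simp only [rot, Real.cos_add_pi_div_two, Real.sin_add_pi_div_two, Prod.fst_add,
        Prod.snd_add] <;> ring
  · refine h2.trans ?_
    rintro _ ⟨z, ⟨hz1, hz2⟩, rfl⟩
    refine ⟨(z.2, a - z.1), ⟨hz2, ⟨?_, ?_⟩⟩, ?_⟩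
    · simp only [Set.mem_Icc] at hz1 ⊢; linarith [hz1.2]
    · simp only [Set.mem_Icc] at hz1 ⊢; linarith [hz1.1]
    · ext <;> simp only [rot, Real.cos_add_pi_div_two, Real.sin_add_pi_div_two, Prod.fst_add,
        Prod.snd_add] <;> ring

lemma exists_finset_fibers (T : Finset ℤ) (F : ℤ → Finset ℤ) :
    ∃ G : Finset (ℤ × ℤ), (∀ n, n ∈ G ↔ n.1 ∈ T ∧ n.2 ∈ F n.1) ∧
      G.card = ∑ m ∈ T, (F m).card := by
  refine ⟨(T.sigma F).map (Equiv.sigmaEquivProd ℤ ℤ).toEmbedding, ?_, ?_⟩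
  · rintro ⟨m, n⟩
    simp [Finset.mem_map_equiv]
  · rw [card_map, card_sigma]

set_option maxHeartbeats 1000000 in
/-- The count of lattice points in a tilted rectangle, compared with its area, in terms of a bound
`K` for sawtooth sums along the slopes of the sides. -/
lemma abs_latticeDisc_le_of_pos {φ a b : ℝ} {c : ℝ × ℝ} {R : Set (ℝ × ℝ)} (ha : 0 < a)
    (hb : 0 < b)
    (hR₁ : (fun z => c + rot φ z) '' (Set.Ioo 0 a ×ˢ Set.Ioo 0 b) ⊆ R)
    (hR₂ : R ⊆ (fun z => c + rot φ z) '' (Set.Icc 0 a ×ˢ Set.Icc 0 b))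
    (hs : 0 < Real.sin φ) (hk : 0 < Real.cos φ) {H : ℕ}
    (hH : a * Real.cos φ + b * Real.sin φ + 1 ≤ H) {K : ℝ}
    (hK : ∀ σ : ℝ, |σ| = Real.tan φ ∨ |σ| = (Real.tan φ)⁻¹ → ∀ n ≤ H, ∀ γ : ℝ,
      |∑ i ∈ range n, saw (σ * i + γ)| ≤ K) :
    |latticeDisc R| ≤ 4 * K + (Real.tan φ + (Real.tan φ)⁻¹) / 2 := by
  have hsk := Real.sin_sq_add_cos_sq φ
  rw [Real.tan_eq_sin_div_cos, inv_div] at *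
  set s := Real.sin φ with hsdef
  set k := Real.cos φ with hkdef
  have hvol : (volume R).toReal = a * b := by
    have hIoo : volume ((fun z => c + rot φ z) '' (Set.Ioo 0 a ×ˢ Set.Ioo 0 b)) =
        ENNReal.ofReal (a * b) := by
      rw [volume_image_add_rot, Measure.volume_eq_prod, Measure.prod_prod, Real.volume_Ioo,
        Real.volume_Ioo, sub_zero, sub_zero, ENNReal.ofReal_mul ha.le]
    have hIcc : volume ((fun z => c + rot φ z) '' (Set.Icc 0 a ×ˢ Set.Icc 0 b)) =
        ENNReal.ofReal (a * b) := by
      rw [volume_image_add_rot, Measure.volume_eq_prod, Measure.prod_prod, Real.volume_Icc,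
        Real.volume_Icc, sub_zero, sub_zero, ENNReal.ofReal_mul ha.le]
    have : volume R = ENNReal.ofReal (a * b) :=
      le_antisymm ((measure_mono hR₂).trans hIcc.le) (hIoo.ge.trans (measure_mono hR₁))
    rw [this, ENNReal.toReal_ofReal (by positivity)]
  set h : ℝ := s / k + k / s with hh
  have hhpos : 0 < h := by positivity
  have hhsk : h * (s * k) = 1 := by
    rw [hh]; field_simp; linarith
  -- The four sides, solved for the ordinate over x = m: the lower boundary is the maximum of `l₁`
  -- and `l₂`, the upper one the minimum of `u₁` and `u₂`.
  set l₁ : ℤ → ℝ := fun m => -(k / s) * m + (c.2 + k / s * c.1) with hl₁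
  set l₂ : ℤ → ℝ := fun m => s / k * m + (c.2 - s / k * c.1) with hl₂
  set u₁ : ℤ → ℝ := fun m => s / k * m + (c.2 + b / k - s / k * c.1) with hu₁
  set u₂ : ℤ → ℝ := fun m => -(k / s) * m + (c.2 + a / s + k / s * c.1) with hu₂
  set l : ℤ → ℝ := fun m => max (l₁ m) (l₂ m) with hl
  set u : ℤ → ℝ := fun m => min (u₁ m) (u₂ m) with hu
  have d21 : ∀ m : ℤ, l₂ m - l₁ m = h * (m - c.1) := by
    intro m; simp only [hl₁, hl₂, hh]; ring
  have hbk : b / k = h * (s * b) := by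
    rw [div_eq_iff hk.ne']; linear_combination (-b) * hhsk
  have has : a / s = h * (k * a) := by
    rw [div_eq_iff hs.ne']; linear_combination (-a) * hhsk
  have dul1 : ∀ m : ℤ, u₁ m - l₁ m = h * (m - (c.1 - b * s)) := by
    intro m
    have : u₁ m - l₁ m = b / k + h * (m - c.1) := by simp only [hl₁, hu₁, hh]; ring
    rw [this, hbk]; ring
  have du : ∀ m : ℤ, u₁ m - u₂ m = h * (m - (c.1 + a * k - b * s)) := by
    intro m
    have : u₁ m - u₂ m = b / k - a / s + h * (m - c.1) := by simp only [hu₂, hu₁, hh]; ring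
    rw [this, hbk, has]; ring
  have leq : ∀ m : ℤ, l m = l₁ m + h * max (m - c.1) 0 := by
    intro m
    rw [mul_max_of_nonneg _ _ hhpos.le, ← d21, mul_zero, ← max_add_add_left, hl, max_comm]
    simp
  have ueq : ∀ m : ℤ, u m = u₁ m - h * max (m - (c.1 + a * k - b * s)) 0 := by
    intro m
    rw [mul_max_of_nonneg _ _ hhpos.le, ← du, mul_zero]
    change min (u₁ m) (u₂ m) = _
    rcases le_total (u₁ m) (u₂ m) with h1 | h1
    · rw [max_eq_right (by linarith), min_eq_left h1, sub_zero]
    · rw [max_eq_left (by linarith), min_eq_right h1]; ring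
  set A : ℤ := ⌈c.1 - b * s⌉ with hA
  set B : ℤ := ⌊c.1 + a * k⌋ with hB
  have hAle : c.1 - b * s ≤ A := Int.le_ceil _
  have hAlt : (A : ℝ) - 1 ≤ c.1 - b * s := by
    have := Int.ceil_lt_add_one (c.1 - b * s); linarith
  have hBle : (B : ℝ) ≤ c.1 + a * k := Int.floor_le _
  have hBlt : c.1 + a * k ≤ B + 1 := (Int.lt_floor_add_one _).le
  have hak : 0 < a * k := by positivity
  have hbs : 0 < b * s := by positivity
  have hABH : B + 1 - A ≤ H := by
    have : ((B + 1 - A : ℤ) : ℝ) ≤ (H : ℤ) := by push_cast; linarith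
    exact_mod_cast this
  have hmem : ∀ m ∈ Icc A B, c.1 - b * s ≤ m ∧ (m : ℝ) ≤ c.1 + a * k := by
    intro m hm
    rw [mem_Icc] at hm
    have h1 : (A : ℝ) ≤ m := by exact_mod_cast hm.1
    have h2 : (m : ℝ) ≤ B := by exact_mod_cast hm.2
    constructor <;> linarith
  -- The last hinge vanishes for m ≤ B. It is added so that the four hinges form a mixed second
  -- difference, whose quadratic main terms collapse to the area.
  have hlen : ∀ m ∈ Icc A B, u m - l m = h * (max ((m : ℝ) - (c.1 - b * s)) 0 -
      max ((m : ℝ) - c.1) 0 - max ((m : ℝ) - (c.1 + a * k - b * s)) 0 +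
      max ((m : ℝ) - (c.1 + a * k)) 0) := by
    intro m hm
    obtain ⟨h1, h2⟩ := hmem m hm
    rw [ueq, leq, max_eq_left (by linarith : 0 ≤ (m : ℝ) - (c.1 - b * s)),
      max_eq_right (by linarith : (m : ℝ) - (c.1 + a * k) ≤ 0)]
    linear_combination dul1 m
  have hlenpos : ∀ m ∈ Icc A B, l m ≤ u m := by
    intro m hm
    obtain ⟨h1, h2⟩ := hmem m hm
    have e1 := dul1 m
    have e2 := d21 m
    have e3 := du m
    have p1 : 0 ≤ h * (m - (c.1 - b * s)) := mul_nonneg hhpos.le (by linarith)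
    have p2 : 0 ≤ h * (c.1 + a * k - m) := mul_nonneg hhpos.le (by linarith)
    have p3 : 0 < h * (b * s) := by positivity
    have p4 : 0 < h * (a * k) := by positivity
    refine max_le (le_min ?_ ?_) (le_min ?_ ?_)
    · linarith
    · linarith
    · linarith
    · linarith
  have hsum : |∑ m ∈ Icc A B, (u m - l m) - a * b| ≤ h / 2 := by
    rw [sum_congr rfl hlen, ← mul_sum, sum_add_distrib, sum_sub_distrib, sum_sub_distrib]
    have q0 := abs_sum_hinge_sub_le (A := A) (B := B) (x := c.1 - b * s) hAlt (by linarith)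
    have q1 := abs_sum_hinge_sub_le (A := A) (B := B) (x := c.1) (by linarith) (by linarith)
    have q2 := abs_sum_hinge_sub_le (A := A) (B := B) (x := c.1 + a * k - b * s) (by linarith)
      (by linarith)
    have q3 := abs_sum_hinge_sub_le (A := A) (B := B) (x := c.1 + a * k) (by linarith)
      (by linarith)
    set S0 := ∑ m ∈ Icc A B, max ((m : ℝ) - (c.1 - b * s)) 0
    set S1 := ∑ m ∈ Icc A B, max ((m : ℝ) - c.1) 0
    set S2 := ∑ m ∈ Icc A B, max ((m : ℝ) - (c.1 + a * k - b * s)) 0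
    set S3 := ∑ m ∈ Icc A B, max ((m : ℝ) - (c.1 + a * k)) 0
    -- The four polynomials (B - x)(B - x + 1)/2 combine to exactly absk, and h·sk = 1. The four
    -- errors of 1/8 give h/2.
    have hab : a * b = h * (a * b * (s * k)) := by linear_combination -(a * b) * hhsk
    have e : h * (S0 - S1 - S2 + S3) - a * b = h * (S0 - S1 - S2 + S3 - a * b * (s * k)) := by
      linear_combination (-1 : ℝ) * hab
    rw [e, abs_mul, abs_of_pos hhpos, div_eq_mul_inv]
    refine mul_le_mul_of_nonneg_left ?_ hhpos.le
    rw [abs_le] at *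
    constructor <;> nlinarith
  have e₁ : ∀ m n : ℤ, s * (n - l₁ m) = k * (m - c.1) + s * (n - c.2) := by
    intro m n; simp only [hl₁]; field_simp; ring
  have e₂ : ∀ m n : ℤ, k * (n - l₂ m) = -(s * (m - c.1)) + k * (n - c.2) := by
    intro m n; simp only [hl₂]; field_simp; ring
  have e₃ : ∀ m n : ℤ, k * (u₁ m - n) = b - (-(s * (m - c.1)) + k * (n - c.2)) := by
    intro m n; simp only [hu₁]; field_simp; ring
  have e₄ : ∀ m n : ℤ, s * (u₂ m - n) = a - (k * (m - c.1) + s * (n - c.2)) := by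
    intro m n; simp only [hu₂]; field_simp; ring
  -- `R` contains an unspecified part of its boundary, so its points are enclosed between those of
  -- the closed chords (`G₁`) and those of the open chords (`G₂`).
  obtain ⟨G₁, hG₁, hG₁c⟩ := exists_finset_fibers (Icc A B) (fun m => Icc ⌈l m⌉ ⌊u m⌋)
  obtain ⟨G₂, hG₂, hG₂c⟩ := exists_finset_fibers (Icc A B) (fun m => Ioo ⌊l m⌋ ⌈u m⌉)
  have hsub₁ : {n : ℤ × ℤ | ((n.1 : ℝ), (n.2 : ℝ)) ∈ R} ⊆ ↑G₁ := by
    rintro ⟨m, n⟩ hn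
    have hn' := mem_image_add_rot.1 (hR₂ hn)
    simp only [rot, Real.cos_neg, Real.sin_neg, Set.mem_prod, Set.mem_Icc, ← hsdef, ← hkdef,
      Prod.fst_sub, Prod.snd_sub, neg_mul, sub_neg_eq_add] at hn'
    obtain ⟨⟨h1, h2⟩, h3, h4⟩ := hn'
    have hX : (m : ℝ) - c.1 = k * (k * (m - c.1) + s * (n - c.2)) -
        s * (-(s * (m - c.1)) + k * (n - c.2)) := by
      linear_combination (-((m : ℝ) - c.1)) * hsk
    have w1 := mul_le_mul_of_nonneg_left h1 hk.le
    have w2 := mul_le_mul_of_nonneg_left h2 hk.le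
    have w3 := mul_le_mul_of_nonneg_left h3 hs.le
    have w4 := mul_le_mul_of_nonneg_left h4 hs.le
    rw [Finset.mem_coe, hG₁]
    simp only [mem_Icc, hA, hB, Int.ceil_le, Int.le_floor, hl, hu, max_le_iff, le_min_iff]
    refine ⟨⟨by linarith, by linarith⟩, ⟨?_, ?_⟩, ?_, ?_⟩ <;> rw [← sub_nonneg]
    · rwa [← mul_nonneg_iff_of_pos_left hs, e₁]
    · rwa [← mul_nonneg_iff_of_pos_left hk, e₂]
    · rw [← mul_nonneg_iff_of_pos_left hk, e₃]; linarith
    · rw [← mul_nonneg_iff_of_pos_left hs, e₄]; linarith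
  have hsub₂ : ↑G₂ ⊆ {n : ℤ × ℤ | ((n.1 : ℝ), (n.2 : ℝ)) ∈ R} := by
    rintro ⟨m, n⟩ hn
    rw [Finset.mem_coe, hG₂] at hn
    obtain ⟨-, hn⟩ := hn
    simp only [mem_Ioo, Int.floor_lt, Int.lt_ceil] at hn
    simp only [hl, hu, max_lt_iff, lt_min_iff] at hn
    obtain ⟨⟨h1, h2⟩, h3, h4⟩ := hn
    rw [← sub_pos, ← mul_pos_iff_of_pos_left hs, e₁] at h1
    rw [← sub_pos, ← mul_pos_iff_of_pos_left hk, e₂] at h2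
    rw [← sub_pos, ← mul_pos_iff_of_pos_left hk, e₃] at h3
    rw [← sub_pos, ← mul_pos_iff_of_pos_left hs, e₄] at h4
    refine hR₁ (mem_image_add_rot.2 ?_)
    simp only [rot, Real.cos_neg, Real.sin_neg, Set.mem_prod, Set.mem_Ioo, ← hsdef, ← hkdef,
      Prod.fst_sub, Prod.snd_sub, neg_mul, sub_neg_eq_add]
    exact ⟨⟨h1, by linarith⟩, h2, by linarith⟩
  have hfin : {n : ℤ × ℤ | ((n.1 : ℝ), (n.2 : ℝ)) ∈ R}.Finite := G₁.finite_toSet.subset hsub₁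
  have hsl : ∀ m : ℤ, u₁ m ≤ u₂ m ↔ (m : ℝ) ≤ c.1 + a * k - b * s := by
    intro m
    rw [← sub_nonpos, du, ← sub_nonpos (b := c.1 + a * k - b * s), ← not_lt, ← not_lt,
      mul_pos_iff_of_pos_left hhpos]
  have hll : ∀ m : ℤ, l₂ m ≤ l₁ m ↔ (m : ℝ) ≤ c.1 := by
    intro m
    rw [← sub_nonpos, d21, ← sub_nonpos (b := c.1), ← not_lt, ← not_lt,
      mul_pos_iff_of_pos_left hhpos]
  have hsk0 : 0 < s / k := by positivity
  have hks0 : 0 < k / s := by positivity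
  have K1 := hK (s / k) (Or.inl (abs_of_pos hsk0))
  have K2 := hK (-(s / k)) (Or.inl (by rw [abs_neg, abs_of_pos hsk0]))
  have K3 := hK (k / s) (Or.inr (abs_of_pos hks0))
  have K4 := hK (-(k / s)) (Or.inr (by rw [abs_neg, abs_of_pos hks0]))
  have T1 : |∑ m ∈ Icc A B, saw (u m)| ≤ 2 * K := by
    refine abs_sum_Icc_saw_piecewise_le K1 K4 (x := c.1 + a * k - b * s)
      (fun m hm => min_eq_left ((hsl m).2 hm))
      (fun m hm => min_eq_right (le_of_not_ge fun h1 => absurd ((hsl m).1 h1) (not_le.2 hm))) hABH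
  have T2 : |∑ m ∈ Icc A B, saw (-u m)| ≤ 2 * K := by
    refine abs_sum_Icc_saw_piecewise_le K2 K3 (x := c.1 + a * k - b * s)
      (γ₁ := -(c.2 + b / k - s / k * c.1)) (γ₂ := -(c.2 + a / s + k / s * c.1))
      (fun m hm => ?_) (fun m hm => ?_) hABH
    · rw [hu]; simp only; rw [min_eq_left ((hsl m).2 hm), hu₁]; ring
    · rw [hu]; simp only
      rw [min_eq_right (le_of_not_ge fun h1 => absurd ((hsl m).1 h1) (not_le.2 hm)), hu₂]; ring
  have T3 : |∑ m ∈ Icc A B, saw (l m)| ≤ 2 * K := by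
    refine abs_sum_Icc_saw_piecewise_le K4 K1 (x := c.1)
      (fun m hm => max_eq_left ((hll m).2 hm))
      (fun m hm => max_eq_right (le_of_not_ge fun h1 => absurd ((hll m).1 h1) (not_le.2 hm))) hABH
  have T4 : |∑ m ∈ Icc A B, saw (-l m)| ≤ 2 * K := by
    refine abs_sum_Icc_saw_piecewise_le K3 K2 (x := c.1)
      (γ₁ := -(c.2 + k / s * c.1)) (γ₂ := -(c.2 - s / k * c.1))
      (fun m hm => ?_) (fun m hm => ?_) hABH
    · rw [hl]; simp only; rw [max_eq_left ((hll m).2 hm), hl₁]; ring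
    · rw [hl]; simp only
      rw [max_eq_right (le_of_not_ge fun h1 => absurd ((hll m).1 h1) (not_le.2 hm)), hl₂]; ring
  have hupper : ((Set.ncard {n : ℤ × ℤ | ((n.1 : ℝ), (n.2 : ℝ)) ∈ R} : ℕ) : ℝ) ≤
      ∑ m ∈ Icc A B, ((u m - l m) - saw (u m) - saw (-l m)) := by
    have h1 : Set.ncard {n : ℤ × ℤ | ((n.1 : ℝ), (n.2 : ℝ)) ∈ R} ≤ G₁.card := by
      rw [← Set.ncard_coe_finset]
      exact Set.ncard_le_ncard hsub₁ G₁.finite_toSet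
    calc _ ≤ (G₁.card : ℝ) := by exact_mod_cast h1
      _ = ∑ m ∈ Icc A B, ((Icc ⌈l m⌉ ⌊u m⌋).card : ℝ) := by rw [hG₁c]; push_cast; rfl
      _ ≤ _ := by
        refine sum_le_sum fun m hm => ?_
        have h2 : ⌈l m⌉ ≤ ⌊u m⌋ + 1 := by
          rw [Int.ceil_le]; push_cast
          have := Int.lt_floor_add_one (u m)
          have := hlenpos m hm
          linarith
        have h3 : (((Icc ⌈l m⌉ ⌊u m⌋).card : ℤ) : ℝ) = ((⌊u m⌋ + 1 - ⌈l m⌉ : ℤ) : ℝ) := by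
          rw [Int.card_Icc, Int.toNat_of_nonneg (by omega)]
        have h4 : ⌈l m⌉ = -⌊-l m⌋ := by rw [Int.floor_neg, neg_neg]
        have h5 := Int.floor_add_fract (u m)
        have h6 := Int.floor_add_fract (-l m)
        rw [Int.cast_natCast] at h3
        rw [h3, h4]
        simp only [saw]
        push_cast
        linarith
  have hlower : ∑ m ∈ Icc A B, ((u m - l m) + saw (-u m) + saw (l m)) ≤
      ((Set.ncard {n : ℤ × ℤ | ((n.1 : ℝ), (n.2 : ℝ)) ∈ R} : ℕ) : ℝ) := by
    have h1 : G₂.card ≤ Set.ncard {n : ℤ × ℤ | ((n.1 : ℝ), (n.2 : ℝ)) ∈ R} := by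
      rw [← Set.ncard_coe_finset]
      exact Set.ncard_le_ncard hsub₂ hfin
    calc _ ≤ ∑ m ∈ Icc A B, ((Ioo ⌊l m⌋ ⌈u m⌉).card : ℝ) := by
          refine sum_le_sum fun m hm => ?_
          have h3 : ((⌈u m⌉ - ⌊l m⌋ - 1 : ℤ) : ℝ) ≤ (((Ioo ⌊l m⌋ ⌈u m⌉).card : ℤ) : ℝ) := by
            rw [Int.card_Ioo]
            exact_mod_cast Int.self_le_toNat _
          have h4 : ⌈u m⌉ = -⌊-u m⌋ := by rw [Int.floor_neg, neg_neg]
          have h5 := Int.floor_add_fract (-u m)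
          have h6 := Int.floor_add_fract (l m)
          rw [Int.cast_natCast] at h3
          refine le_trans ?_ h3
          rw [h4]
          simp only [saw]
          push_cast
          linarith
      _ = (G₂.card : ℝ) := by rw [hG₂c]; push_cast; rfl
      _ ≤ _ := by exact_mod_cast h1
  rw [sum_sub_distrib, sum_sub_distrib] at hupper
  rw [sum_add_distrib, sum_add_distrib] at hlower
  rw [latticeDisc, hvol]
  rw [abs_le] at *
  constructor <;> linarith [T1.1, T2.1, T3.1, T4.1]

end DirDisc

/-! ### From good angles to discrepancy bounds. -/

namespace DirDisc
open Finset MeasureTheory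

/-- A rectangle may be described from any of its corners, so its angle matters only modulo quarter
turns. An odd number of them exchanges tan with -cot. -/
lemma IsRectangle.exists_first_quadrant {φ : ℝ} {R : Set (ℝ × ℝ)} (h : IsRectangle φ R)
    (hs : Real.sin φ ≠ 0) (hc : Real.cos φ ≠ 0) :
    ∃ ψ, IsRectangle ψ R ∧ 0 < Real.sin ψ ∧ 0 < Real.cos ψ ∧
      (Real.tan ψ = |Real.tan φ| ∨ Real.tan ψ = |Real.tan φ|⁻¹) := by
  have h1 := h.add_pi_div_two
  have h2 := h1.add_pi_div_two
  have h3 := h2.add_pi_div_two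
  rcases lt_or_gt_of_ne hs with hs | hs <;> rcases lt_or_gt_of_ne hc with hc | hc
  · refine ⟨_, h2, ?_, ?_, Or.inl ?_⟩
    · simp only [Real.sin_add_pi_div_two, Real.cos_add_pi_div_two]; linarith
    · simp only [Real.sin_add_pi_div_two, Real.cos_add_pi_div_two]; linarith
    · simp only [Real.tan_eq_sin_div_cos, Real.sin_add_pi_div_two, Real.cos_add_pi_div_two,
        abs_div, abs_of_neg hs, abs_of_neg hc]
  · refine ⟨_, h1, ?_, ?_, Or.inr ?_⟩
    · rwa [Real.sin_add_pi_div_two]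
    · rw [Real.cos_add_pi_div_two]; linarith
    · simp only [Real.tan_eq_sin_div_cos, Real.sin_add_pi_div_two, Real.cos_add_pi_div_two,
        abs_div, abs_of_neg hs, abs_of_pos hc, inv_div]
  · refine ⟨_, h3, ?_, ?_, Or.inr ?_⟩
    · simp only [Real.sin_add_pi_div_two, Real.cos_add_pi_div_two]; linarith
    · simp only [Real.sin_add_pi_div_two, Real.cos_add_pi_div_two]; linarith
    · simp only [Real.tan_eq_sin_div_cos, Real.sin_add_pi_div_two, Real.cos_add_pi_div_two,
        abs_div, abs_of_pos hs, abs_of_neg hc, inv_div, neg_neg]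
  · exact ⟨φ, h, hs, hc, Or.inl (by
      rw [Real.tan_eq_sin_div_cos, abs_of_pos (div_pos hs hc)])⟩

lemma abs_fst_le_of_mem_rotSquare {N : ℕ} {β : ℝ} {z : ℝ × ℝ} (hz : z ∈ rotSquare N β) :
    |z.1| ≤ 2 * Real.sqrt N := by
  obtain ⟨w, ⟨⟨h1, h2⟩, h3, h4⟩, rfl⟩ := hz
  have hc := Real.abs_cos_le_one β
  have hs := Real.abs_sin_le_one β
  simp only [rot]
  calc |Real.cos β * w.1 - Real.sin β * w.2| ≤ |Real.cos β * w.1| + |Real.sin β * w.2| :=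
        abs_sub _ _
    _ = |Real.cos β| * w.1 + |Real.sin β| * w.2 := by
        rw [abs_mul, abs_mul, abs_of_nonneg h1, abs_of_nonneg h3]
    _ ≤ 1 * w.1 + 1 * w.2 := by gcongr
    _ ≤ 2 * Real.sqrt N := by linarith

/-- Corners need not belong to `R`, so two interior points on a line parallel to a diagonal are
compared. Their abscissas differ by half the width and by at most 4√N. -/
lemma width_le_of_subset_rotSquare {N : ℕ} {β φ a b : ℝ} {c : ℝ × ℝ} {R : Set (ℝ × ℝ)}
    (ha : 0 < a) (hb : 0 < b)
    (hR : (fun z => c + rot φ z) '' (Set.Ioo 0 a ×ˢ Set.Ioo 0 b) ⊆ R)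
    (hN : R ⊆ rotSquare N β) :
    a * Real.cos φ + b * Real.sin φ ≤ 8 * Real.sqrt N := by
  have p1 : c + rot φ (3 / 4 * a, 1 / 4 * b) ∈ R :=
    hR ⟨_, ⟨⟨by simp only; linarith, by simp only; linarith⟩, by simp only; linarith,
      by simp only; linarith⟩, rfl⟩
  have p2 : c + rot φ (1 / 4 * a, 3 / 4 * b) ∈ R :=
    hR ⟨_, ⟨⟨by simp only; linarith, by simp only; linarith⟩, by simp only; linarith,
      by simp only; linarith⟩, rfl⟩
  have q1 := (abs_le.1 (abs_fst_le_of_mem_rotSquare (hN p1))).2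
  have q2 := (abs_le.1 (abs_fst_le_of_mem_rotSquare (hN p2))).1
  simp only [rot, Prod.fst_add] at q1 q2
  linarith

lemma tan_sub_pi_div_two (x : ℝ) : Real.tan (x - Real.pi / 2) = -(Real.tan x)⁻¹ := by
  rw [Real.tan_eq_sin_div_cos, Real.tan_eq_sin_div_cos, Real.sin_sub_pi_div_two,
    Real.cos_sub_pi_div_two, inv_div, neg_div]

/-- The discrepancy bound for a good angle, in terms of a function `E` which controls the ratio
`H / q` for the Dirichlet approximations `p / q`, `q ≤ H`, of the slopes. -/
theorem discBound_of_isGoodAngle {Ω : Set ℝ} {g : ℕ → ℝ} {α : ℝ} {F : ℕ → ℝ} (hg : g 1 = 1)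
    (hα : IsGoodAngle Ω g α)
    (hE : ∀ c > 0, ∃ E : ℕ → ℝ, Monotone E ∧ (∀ H, 0 ≤ E H) ∧
      (∀ q H : ℕ, 1 ≤ q → q ≤ H → c * g q < 1 / (((H : ℝ) + 1) * q) → (H : ℝ) ≤ q * E H) ∧
      ∃ C, ∀ N : ℕ, 1 ≤ N → ∀ H : ℕ, 1 ≤ H → (H : ℝ) ≤ 10 * Real.sqrt N →
        ((Nat.log 2 H : ℝ) + 1) * E H + 1 ≤ C * F N) :
    DiscBound Ω α F := by
  obtain ⟨c, hc, hgood⟩ := hα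
  obtain ⟨E, hEmono, hE0, hEq, C, hC⟩ := hE c hc
  refine ⟨(20 + c⁻¹) * C, fun N hN β hβ R hR => ?_⟩
  obtain ⟨hRV, hdir⟩ := hR
  obtain ⟨φ, hφR, θ, hθ, hθ', htan⟩ : ∃ φ, IsRectangle φ R ∧ ∃ θ, θ ∈ enlarge Ω ∧
      θ + Real.pi / 2 ∈ enlarge Ω ∧ |Real.tan φ| = |Real.tan (α - θ)| := by
    rcases hdir with h | ⟨θ, hθ, h⟩
    · refine ⟨β, h, 0, by simp [enlarge], by simp [enlarge], ?_⟩
      rcases hβ with rfl | rfl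
      · rw [sub_zero]
      · rw [Real.tan_neg, abs_neg, sub_zero]
    · refine ⟨θ - α, h, θ, Or.inl (Or.inl (Or.inl hθ)), Or.inl (Or.inr ⟨θ, hθ, rfl⟩), ?_⟩
      rw [← neg_sub α θ, Real.tan_neg, abs_neg]
  have hP1 := hgood _ hθ
  have hP2 := hgood _ hθ'
  -- The shift by π/2 in the enlarged set provides goodness of -1/t, the slope of the perpendicular
  -- sides.
  rw [← sub_sub, tan_sub_pi_div_two] at hP2
  set t := Real.tan (α - θ) with ht
  -- The fraction 0/1 alone keeps |t| and 1/|t| above c, which bounds tan + cot by 2/c.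
  have hct : c < |t| := by simpa [hg] using hP1 0 1 le_rfl
  have hct' : c < |t|⁻¹ := by simpa [hg] using hP2 0 1 le_rfl
  have hneg : ∀ σ : ℝ, (∀ p : ℤ, ∀ q : ℕ, 1 ≤ q → c * g q < |σ - p / q|) →
      ∀ p : ℤ, ∀ q : ℕ, 1 ≤ q → c * g q < |(-σ) - p / q| := by
    intro σ h p q hq
    have := h (-p) q hq
    rwa [← abs_neg, show -(σ - ((-p : ℤ) : ℝ) / q) = -σ - p / q by push_cast; ring] at this
  have hP : ∀ σ : ℝ, |σ| = |t| ∨ |σ| = |t|⁻¹ → ∀ p : ℤ, ∀ q : ℕ, 1 ≤ q →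
      c * g q < |σ - p / q| := by
    rintro σ (h | h)
    · rcases abs_eq_abs.1 h with rfl | rfl
      · exact hP1
      · exact hneg _ hP1
    · rw [← abs_inv, ← abs_neg t⁻¹] at h
      rcases abs_eq_abs.1 h with rfl | rfl
      · exact hP2
      · exact hneg _ hP2
  have ht0 : Real.tan φ ≠ 0 := by
    intro h; rw [h, abs_zero] at htan; rw [← htan] at hct; linarith
  have hs0 : Real.sin φ ≠ 0 := fun h => ht0 (by rw [Real.tan_eq_sin_div_cos, h, zero_div])
  have hc0 : Real.cos φ ≠ 0 := fun h => ht0 (by rw [Real.tan_eq_sin_div_cos, h, div_zero])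
  obtain ⟨ψ, ⟨z, a, b, ha, hb, hR1, hR2⟩, hs, hk, hψ⟩ := hφR.exists_first_quadrant hs0 hc0
  rw [htan] at hψ
  set H : ℕ := ⌈8 * Real.sqrt N + 1⌉₊ with hH
  have hH1 : 1 ≤ H := Nat.one_le_ceil_iff.2 (by positivity)
  have hN1 : 1 ≤ Real.sqrt N := Real.one_le_sqrt.2 (by exact_mod_cast hN)
  have hHle : (H : ℝ) ≤ 10 * Real.sqrt N := by
    have := Nat.ceil_lt_add_one (a := 8 * Real.sqrt N + 1) (by positivity)
    linarith
  have hHge : 8 * Real.sqrt N + 1 ≤ H := Nat.le_ceil _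
  have hw := width_le_of_subset_rotSquare ha hb hR1 hRV
  have hK : ∀ σ : ℝ, |σ| = Real.tan ψ ∨ |σ| = (Real.tan ψ)⁻¹ → ∀ n ≤ H, ∀ γ : ℝ,
      |∑ i ∈ range n, saw (σ * i + γ)| ≤ 5 * ((Nat.log 2 H : ℝ) + 1) * E H := by
    intro σ hσ n hn γ
    have hσ' : |σ| = |t| ∨ |σ| = |t|⁻¹ := by
      rcases hψ with h | h <;> rw [h] at hσ
      · exact hσ
      · rw [inv_inv] at hσ; exact hσ.symm
    have hlt : n < 2 ^ (Nat.log 2 H + 1) :=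
      hn.trans_lt (Nat.lt_pow_succ_log_self (by norm_num) H)
    have := abs_sum_saw_le hEmono hE0 (β := σ) ?_ (Nat.log 2 H + 1) n hlt γ
    · refine this.trans ?_
      push_cast
      gcongr
      exact hEmono hn
    · intro m hm
      obtain ⟨r, hr1, hr2⟩ := Real.exists_rat_abs_sub_le_and_den_le σ hm
      refine ⟨r, hr2, hr1, hEq r.den m r.den_pos hr2 (lt_of_lt_of_le ?_ hr1)⟩
      have := hP σ hσ' r.num r.den r.den_pos
      rwa [show (r.num : ℝ) / (r.den : ℝ) = r by exact_mod_cast r.num_div_den] at this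
  have hmain := abs_latticeDisc_le_of_pos ha hb hR1 hR2 hs hk (H := H) (by linarith) hK
  have htt : |t| ≤ c⁻¹ := by
    have := (inv_lt_inv₀ (by linarith) hc).2 hct'
    rw [inv_inv] at this; exact this.le
  have htt' : |t|⁻¹ ≤ c⁻¹ := ((inv_lt_inv₀ (by linarith) hc).2 hct).le
  have hsum : (Real.tan ψ + (Real.tan ψ)⁻¹) / 2 ≤ c⁻¹ := by
    rcases hψ with h | h <;> rw [h]
    · linarith
    · rw [inv_inv]; linarith
  have hfin := hC N hN H hH1 hHle
  have hEH := hE0 H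
  have hL : 0 ≤ ((Nat.log 2 H : ℝ) + 1) * E H := by positivity
  have hcinv : 0 < c⁻¹ := by positivity
  calc |latticeDisc R| ≤ 20 * (((Nat.log 2 H : ℝ) + 1) * E H) + c⁻¹ := by linarith
    _ ≤ (20 + c⁻¹) * (((Nat.log 2 H : ℝ) + 1) * E H + 1) := by nlinarith
    _ ≤ (20 + c⁻¹) * (C * F N) := by gcongr
    _ = _ := by ring

end DirDisc

namespace DirDisc

lemma one_le_clog (x : ℝ) : 1 ≤ clog x := le_max_left _ _

lemma clog_le_clog {x y : ℝ} (hx : 0 < x) (h : x ≤ y) : clog x ≤ clog y :=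
  max_le_max le_rfl (Real.logb_le_logb_of_le (by norm_num) hx h)

lemma clog_natCast_mono : Monotone (fun n : ℕ => clog n) := by
  intro m n h
  rcases Nat.eq_zero_or_pos m with rfl | hm
  · simp [clog]
  · exact clog_le_clog (by exact_mod_cast hm) (by exact_mod_cast h)

lemma clog_le_of_le_sqrt {N H : ℕ} (hN : 1 ≤ N) (hH : 1 ≤ H) (h : (H : ℝ) ≤ 10 * Real.sqrt N) :
    clog H ≤ 5 * clog N := by
  have hN' : (1 : ℝ) ≤ N := by exact_mod_cast hN
  have hH' : (1 : ℝ) ≤ H := by exact_mod_cast hH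
  have h1 : Real.sqrt N ≤ N := Real.sqrt_le_iff.2 ⟨by linarith, by nlinarith⟩
  have h2 : (H : ℝ) ≤ 2 ^ (4 : ℕ) * N := by linarith
  have h3 := one_le_clog N
  refine max_le (by linarith) ?_
  calc Real.logb 2 H ≤ Real.logb 2 (2 ^ (4 : ℕ) * N) :=
        Real.logb_le_logb_of_le (by norm_num) (by linarith) h2
    _ = 4 + Real.logb 2 N := by
        rw [Real.logb_mul (by norm_num) (by linarith), Real.logb_pow, Real.logb_self_eq_one
          (by norm_num)]
        norm_num
    _ ≤ 5 * clog N := by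
        have : Real.logb 2 N ≤ clog N := le_max_right _ _
        linarith

lemma natLog_two_le_clog (H : ℕ) : (Nat.log 2 H : ℝ) ≤ clog H := by
  have := Real.natLog_le_logb H 2
  exact this.trans (le_max_right _ _)

theorem discBound_clog {Ω : Set ℝ} {α : ℝ} (M : ℕ)
    (hα : IsGoodAngle Ω (fun q => 1 / ((q : ℝ) ^ 2 * clog q ^ (2 * M))) α) :
    DiscBound Ω α (fun N => clog N ^ (2 * M + 1)) := by
  refine discBound_of_isGoodAngle (by simp [clog]) hα fun c hc => ?_
  -- For q ≤ H the hypothesis on g reads c(H + 1) < q log^(2M) q, which dictates this E.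
  refine ⟨fun H => clog H ^ (2 * M) / c, ?_, ?_, ?_, 2 * 5 ^ (2 * M + 1) / c + 1, ?_⟩
  · intro m n h
    have h1 := one_le_clog m
    have h2 : clog m ≤ clog n := clog_natCast_mono h
    simp only
    gcongr
  · intro H
    have := one_le_clog H
    positivity
  · intro q H hq hqH h
    have hq' : (0 : ℝ) < q := by exact_mod_cast hq
    have h1 := one_le_clog q
    have h2 : clog q ≤ clog H := clog_natCast_mono hqH
    have hL : 0 < clog q ^ (2 * M) := by positivity
    rw [mul_one_div, div_lt_div_iff₀ (by positivity) (by positivity)] at h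
    have h3 : c * (H + 1) < q * clog q ^ (2 * M) := by
      have : q * (c * (H + 1)) < q * (q * clog q ^ (2 * M)) := by
        calc q * (c * (H + 1)) = c * ((H + 1) * q) := by ring
          _ < _ := h
          _ = _ := by ring
      exact lt_of_mul_lt_mul_left this hq'.le
    have h4 : (q : ℝ) * clog q ^ (2 * M) ≤ q * clog H ^ (2 * M) := by gcongr
    simp only
    rw [← mul_div_assoc, le_div_iff₀ hc]
    nlinarith
  · intro N hN H hH1 hH
    have h1 := clog_le_of_le_sqrt hN hH1 hH
    have h2 := natLog_two_le_clog H
    have h3 := one_le_clog H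
    have h4 := one_le_clog N
    have h5 : 1 ≤ clog N ^ (2 * M + 1) := one_le_pow₀ h4
    calc ((Nat.log 2 H : ℝ) + 1) * (clog H ^ (2 * M) / c) + 1
        ≤ (2 * clog H) * (clog H ^ (2 * M) / c) + 1 := by
          gcongr; linarith
      _ = 2 * clog H ^ (2 * M + 1) / c + 1 := by ring
      _ ≤ 2 * (5 * clog N) ^ (2 * M + 1) / c + 1 := by gcongr
      _ = (2 * 5 ^ (2 * M + 1) / c) * clog N ^ (2 * M + 1) + 1 := by rw [mul_pow]; ring
      _ ≤ _ := by rw [add_mul]; linarith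

theorem discBound_rpow {Ω : Set ℝ} {α τ ε : ℝ} (hτ : 0 ≤ τ) (hε : 0 < ε)
    (hα : IsGoodAngle Ω (fun q => (q : ℝ) ^ (-(τ + 2 + ε))) α) :
    DiscBound Ω α (fun N => (N : ℝ) ^ (τ / (2 * (τ + 1)) + ε)) := by
  refine discBound_of_isGoodAngle (by simp) hα fun c hc => ?_
  -- Goodness gives cH ≤ q^(τ+1+ε), that is q ≥ (cH)^e, so H/q is at most c^(-e) H^(1-e).
  set e : ℝ := 1 / (τ + 1 + ε) with he
  have he0 : 0 < e := by positivity
  have he1 : e < 1 := by rw [he, div_lt_one (by positivity)]; linarith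
  refine ⟨fun H => c ^ (-e) * (H : ℝ) ^ (1 - e), ?_, ?_, ?_,
    (1 / (ε * Real.log 2) + 1) * c ^ (-e) * 10 ^ (ε + (1 - e)) + 1, ?_⟩
  · intro m n h
    simp only
    gcongr
  · intro H; positivity
  · intro q H hq hqH h
    have hq' : (0 : ℝ) < q := by exact_mod_cast hq
    have hH' : (0 : ℝ) < H := by exact_mod_cast hq.trans hqH
    have h1 : c * H ≤ (q : ℝ) ^ (τ + 1 + ε) := by
      rw [lt_div_iff₀ (by positivity)] at h
      have h2 : (q : ℝ) ^ (τ + 1 + ε) * (q : ℝ) ^ (-(τ + 2 + ε)) * q = 1 := by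
        rw [← Real.rpow_add hq', ← Real.rpow_add_one hq'.ne']
        convert Real.rpow_zero _ using 2
        ring
      have h3 : (q : ℝ) ^ (τ + 1 + ε) * (c * (q : ℝ) ^ (-(τ + 2 + ε)) * ((H + 1) * q)) <
          (q : ℝ) ^ (τ + 1 + ε) * 1 := mul_lt_mul_of_pos_left h (by positivity)
      have h4 : (q : ℝ) ^ (τ + 1 + ε) * (c * (q : ℝ) ^ (-(τ + 2 + ε)) * ((H + 1) * q)) =
          c * (H + 1) := by linear_combination c * (H + 1) * h2
      rw [h4] at h3
      linarith
    have h5 : (c * H) ^ e ≤ q := by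
      calc (c * H) ^ e ≤ ((q : ℝ) ^ (τ + 1 + ε)) ^ e := by gcongr
        _ = q := by
          rw [← Real.rpow_mul hq'.le, he, mul_one_div_cancel (by positivity), Real.rpow_one]
    calc (H : ℝ) = (c * H) ^ e * (c ^ (-e) * (H : ℝ) ^ (1 - e)) := by
          rw [Real.mul_rpow hc.le hH'.le, Real.rpow_neg hc.le, Real.rpow_sub hH', Real.rpow_one]
          field_simp
      _ ≤ _ := by gcongr
  · intro N hN H hH1 hH
    have hN' : (1 : ℝ) ≤ N := by exact_mod_cast hN
    have hH' : (1 : ℝ) ≤ H := by exact_mod_cast hH1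
    have hlog2 : 0 < Real.log 2 := Real.log_pos (by norm_num)
    have h1 : (Nat.log 2 H : ℝ) + 1 ≤ (1 / (ε * Real.log 2) + 1) * (H : ℝ) ^ ε := by
      have a1 : (Nat.log 2 H : ℝ) ≤ Real.logb 2 H := Real.natLog_le_logb H 2
      have a2 := Real.log_le_rpow_div (by linarith : (0 : ℝ) ≤ H) hε
      have a3 : (1 : ℝ) ≤ (H : ℝ) ^ ε := Real.one_le_rpow hH' hε.le
      have a4 : Real.logb 2 H ≤ (H : ℝ) ^ ε / ε / Real.log 2 := by
        rw [Real.logb]; gcongr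
      calc (Nat.log 2 H : ℝ) + 1 ≤ (H : ℝ) ^ ε / ε / Real.log 2 + (H : ℝ) ^ ε := by linarith
        _ = _ := by field_simp
    -- The logarithm costs H^ε, and replacing e by 1/(τ + 1) costs at most another ε. Since H =
    -- O(√N), the exponent is halved, so one ε remains in total.
    have hexp : (ε + (1 - e)) / 2 ≤ τ / (2 * (τ + 1)) + ε := by
      have b1 : 1 / (τ + 1) - e ≤ ε := by
        rw [he, div_sub_div _ _ (by positivity) (by positivity), div_le_iff₀ (by positivity)]
        nlinarith [mul_nonneg hτ hε.le, mul_nonneg hτ (sq_nonneg ε), sq_nonneg ε,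
          mul_nonneg (mul_nonneg hτ hτ) hε.le]
      have b2 : τ / (2 * (τ + 1)) = (1 - 1 / (τ + 1)) / 2 := by field_simp; ring
      rw [b2]; linarith
    have h2 : (H : ℝ) ^ (ε + (1 - e)) ≤
        10 ^ (ε + (1 - e)) * (N : ℝ) ^ (τ / (2 * (τ + 1)) + ε) := by
      calc (H : ℝ) ^ (ε + (1 - e)) ≤ (10 * Real.sqrt N) ^ (ε + (1 - e)) := by
            gcongr
        _ = 10 ^ (ε + (1 - e)) * (N : ℝ) ^ ((ε + (1 - e)) / 2) := by
            rw [Real.mul_rpow (by norm_num) (by positivity), Real.sqrt_eq_rpow,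
              ← Real.rpow_mul (by linarith)]
            congr 2; ring
        _ ≤ _ := by gcongr
    have h3 : 1 ≤ (N : ℝ) ^ (τ / (2 * (τ + 1)) + ε) := Real.one_le_rpow hN' (by positivity)
    calc ((Nat.log 2 H : ℝ) + 1) * (c ^ (-e) * (H : ℝ) ^ (1 - e)) + 1
        ≤ ((1 / (ε * Real.log 2) + 1) * (H : ℝ) ^ ε) * (c ^ (-e) * (H : ℝ) ^ (1 - e)) + 1 := by
          gcongr
      _ = (1 / (ε * Real.log 2) + 1) * c ^ (-e) * (H : ℝ) ^ (ε + (1 - e)) + 1 := by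
          rw [Real.rpow_add (by linarith)]; ring
      _ ≤ (1 / (ε * Real.log 2) + 1) * c ^ (-e) *
            (10 ^ (ε + (1 - e)) * (N : ℝ) ^ (τ / (2 * (τ + 1)) + ε)) + 1 := by gcongr
      _ ≤ _ := by rw [add_mul, ← mul_assoc]; linarith

end DirDisc

/-! ### Existence of good angles from coverings. -/

namespace DirDisc
open Finset

/-- `Ω` is covered by the intervals `[x, x + δ]`, `x ∈ F`. -/
def CoveredBy (Ω : Set ℝ) (δ : ℝ) (F : Finset ℝ) : Prop :=
  ∀ θ ∈ Ω, ∃ x ∈ F, x ≤ θ ∧ θ ≤ x + δ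

/-- If the bad points are distributed over few cells and the bad points of one cell are close to
each other, then some subinterval contains no bad point. -/
lemma exists_subinterval_forall_not {a L ℓ : ℝ} (hℓ : 0 < ℓ) {F : Finset ℝ}
    (hF : 12 * ((F.card : ℝ) + 1) * ℓ ≤ L) (Bad : ℝ → ℝ → Prop)
    (hBad : ∀ x ∈ F, ∀ α ∈ Set.Icc a (a + L), ∀ β ∈ Set.Icc a (a + L), Bad x α → Bad x β →
      |α - β| ≤ 5 * ℓ) :
    ∃ b, a ≤ b ∧ b + ℓ ≤ a + L ∧ ∀ x ∈ F, ∀ α ∈ Set.Icc b (b + ℓ), ¬ Bad x α := by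
  by_contra! hcon
  -- There is one more candidate interval than cells. Candidates start 12ℓ apart, so bad points of
  -- two of them are at least 11ℓ apart and cannot share a cell.
  have hin : ∀ i ∈ range (F.card + 1), a ≤ a + 12 * ℓ * i ∧ a + 12 * ℓ * i + ℓ ≤ a + L := by
    intro i hi
    have hi' : (i : ℝ) + 1 ≤ F.card + 1 := by
      have := mem_range.1 hi
      exact_mod_cast this
    have h1 : 12 * ((i : ℝ) + 1) * ℓ ≤ 12 * ((F.card : ℝ) + 1) * ℓ := by gcongr
    constructor
    · have : 0 ≤ 12 * ℓ * i := by positivity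
      linarith
    · linarith
  have h1 : ∀ i ∈ range (F.card + 1), ∃ x ∈ F,
      ∃ α ∈ Set.Icc (a + 12 * ℓ * i) (a + 12 * ℓ * i + ℓ), Bad x α :=
    fun i hi => hcon _ (hin i hi).1 (hin i hi).2
  choose! f hf α hα hαbad using h1
  obtain ⟨i, hi, j, hj, hij, hfij⟩ :=
    exists_ne_map_eq_of_card_lt_of_maps_to (by simp) hf
  have hmem : ∀ i ∈ range (F.card + 1), α i ∈ Set.Icc a (a + L) := fun i hi =>
    ⟨(hin i hi).1.trans (hα i hi).1, (hα i hi).2.trans (hin i hi).2⟩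
  have key : ∀ i ∈ range (F.card + 1), ∀ j ∈ range (F.card + 1), i < j → f i ≠ f j := by
    intro i hi j hj hlt hfij
    have h2 := hBad (f i) (hf i hi) (α i) (hmem i hi) (α j) (hmem j hj) (hαbad i hi)
      (hfij ▸ hαbad j hj)
    have h3 : (i : ℝ) + 1 ≤ j := by exact_mod_cast hlt
    have h4 := (hα i hi).2
    have h5 := (hα j hj).1
    have h6 : 12 * ℓ * ((i : ℝ) + 1) ≤ 12 * ℓ * j := by gcongr
    have h7 := (abs_le.1 h2).1
    linarith
  rcases lt_or_gt_of_ne hij with h | h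
  · exact key i hi j hj h hfij
  · exact key j hj i hi h hfij.symm

/-- Nested intervals avoiding a bad set at every stage. -/
lemma exists_forall_not_of_nested {L : ℕ → ℝ} (hL : ∀ k, 0 ≤ L k) {a₀ : ℝ} (Bad : ℕ → ℝ → Prop)
    (hstep : ∀ k a, a₀ ≤ a → a + L k ≤ a₀ + L 0 → ∃ b, a ≤ b ∧ b + L (k + 1) ≤ a + L k ∧
      ∀ α ∈ Set.Icc b (b + L (k + 1)), ¬ Bad k α) :
    ∃ α ∈ Set.Icc a₀ (a₀ + L 0), ∀ k, ¬ Bad k α := by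
  choose! f hf1 hf2 hf3 using hstep
  let u : ℕ → ℝ := fun n => Nat.rec a₀ (fun k a => f k a) n
  have u0 : u 0 = a₀ := rfl
  have us : ∀ k, u (k + 1) = f k (u k) := fun k => rfl
  have hu : ∀ k, a₀ ≤ u k ∧ u k + L k ≤ a₀ + L 0 := by
    intro k
    induction k with
    | zero => exact ⟨le_rfl, le_rfl⟩
    | succ k ih =>
      rw [us]
      exact ⟨ih.1.trans (hf1 k _ ih.1 ih.2), (hf2 k _ ih.1 ih.2).trans ih.2⟩
  have hmono : Monotone u := monotone_nat_of_le_succ fun k => by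
    rw [us]; exact hf1 k _ (hu k).1 (hu k).2
  have hanti : Antitone (fun k => u k + L k) := antitone_nat_of_succ_le fun k => by
    rw [us]; exact hf2 k _ (hu k).1 (hu k).2
  have hmem := Set.mem_iInter.1 (hmono.ciSup_mem_iInter_Icc_of_antitone hanti
    fun k => le_add_of_nonneg_right (hL k))
  refine ⟨_, hmem 0, fun k => ?_⟩
  have := hmem (k + 1)
  rw [us] at this
  exact hf3 k _ (hu k).1 (hu k).2 _ this

lemma tan_sub_tan {x y : ℝ} (hx : Real.cos x ≠ 0) (hy : Real.cos y ≠ 0) :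
    Real.tan x - Real.tan y = Real.sin (x - y) / (Real.cos x * Real.cos y) := by
  rw [Real.tan_eq_sin_div_cos, Real.tan_eq_sin_div_cos, div_sub_div _ _ hx hy, Real.sin_sub]

lemma abs_tan_sub_tan_le {κ x y : ℝ} (hκ : 0 < κ) (hx : κ ≤ |Real.cos x|)
    (hy : κ ≤ |Real.cos y|) : |Real.tan x - Real.tan y| ≤ |x - y| / κ ^ 2 := by
  rw [tan_sub_tan (abs_pos.1 (hκ.trans_le hx)) (abs_pos.1 (hκ.trans_le hy)), abs_div, abs_mul, sq]
  exact div_le_div₀ (abs_nonneg _) Real.abs_sin_le_abs (by positivity)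
    (mul_le_mul hx hy hκ.le (abs_nonneg _))

lemma abs_sub_le_two_mul_abs_tan_sub_tan {x y : ℝ} (hx : Real.cos x ≠ 0) (hy : Real.cos y ≠ 0)
    (hxy : |x - y| ≤ 1) : |x - y| ≤ 2 * |Real.tan x - Real.tan y| := by
  have h1 : |x - y| ≤ 2 * |Real.sin (x - y)| := by
    have hpi := Real.pi_gt_three
    have hpi4 := Real.pi_le_four
    have h2 := Real.mul_abs_le_abs_sin (x := x - y) (by linarith)
    have h3 : 1 / 2 * |x - y| ≤ 2 / Real.pi * |x - y| := by
      gcongr ?_ * _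
      rw [div_le_div_iff₀ (by norm_num) (by positivity)]; linarith
    linarith
  refine h1.trans ?_
  rw [tan_sub_tan hx hy, abs_div, abs_mul]
  gcongr
  refine le_div_self (abs_nonneg _) (by positivity) ?_
  have := Real.abs_cos_le_one x
  have := Real.abs_cos_le_one y
  calc |Real.cos x| * |Real.cos y| ≤ 1 * 1 := by gcongr
    _ = 1 := one_mul 1

/-- Distinct fractions differ by at least 1/(qq'), and qq' is at most the larger of q² and q'². -/
lemma int_div_nat_eq_of_abs_sub_lt {p p' : ℤ} {q q' : ℕ} (hq : 1 ≤ q) (hq' : 1 ≤ q') {x : ℝ}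
    (hx : (q : ℝ) ^ 2 * x < 1) (hx' : (q' : ℝ) ^ 2 * x < 1)
    (h : |(p : ℝ) / q - p' / q'| ≤ x) : (p : ℝ) / q = p' / q' := by
  have hx0 : 0 ≤ x := (abs_nonneg _).trans h
  have hqR : (1 : ℝ) ≤ q := by exact_mod_cast hq
  have hqR' : (1 : ℝ) ≤ q' := by exact_mod_cast hq'
  have hprod : (q : ℝ) * q' * x < 1 := by
    rcases le_total (q : ℝ) q' with hle | hle
    · refine lt_of_le_of_lt ?_ hx'
      rw [sq]; gcongr
    · refine lt_of_le_of_lt ?_ hx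
      rw [sq]; gcongr
  have h1 : |((p * q' - p' * q : ℤ) : ℝ)| < 1 := by
    have : ((p * q' - p' * q : ℤ) : ℝ) = q * q' * ((p : ℝ) / q - p' / q') := by
      push_cast; field_simp
    rw [this, abs_mul, abs_of_nonneg (by positivity)]
    refine lt_of_le_of_lt ?_ hprod
    gcongr
  have h2 : p * q' - p' * q = 0 := by
    rw [← Int.cast_abs] at h1
    have h3 : |p * q' - p' * q| < 1 := by exact_mod_cast h1
    exact Int.abs_lt_one_iff.1 h3
  have h3 : (p : ℝ) * q' = p' * q := by
    have : p * q' = p' * q := by linarith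
    exact_mod_cast this
  rw [div_eq_div_iff (by positivity) (by positivity), h3]

/-- Distance η from 0 and π/2 keeps α - θ at distance η from ±π/2 for θ in Ω. For the shifted
directions the cosine becomes sin(α - θ), which is controlled by the distance from θ itself. -/
lemma sin_le_abs_cos_sub {Ω : Set ℝ} (hΩ : Ω ⊆ Set.Icc 0 (Real.pi / 2)) {α η : ℝ} (hη : 0 ≤ η)
    (hα : α ∈ Set.Icc 0 (Real.pi / 2)) (hdist : ∀ θ ∈ enlarge Ω, η ≤ |α - θ|) {θ : ℝ}
    (hθ : θ ∈ enlarge Ω) : Real.sin η ≤ |Real.cos (α - θ)| := by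
  have hpi := Real.pi_pos
  have h0 : η ≤ α := by
    have := hdist 0 (by simp [enlarge])
    rwa [sub_zero, abs_of_nonneg hα.1] at this
  have h1 : η ≤ Real.pi / 2 - α := by
    have := hdist (Real.pi / 2) (by simp [enlarge])
    rwa [abs_sub_comm, abs_of_nonneg (by linarith [hα.2])] at this
  have hcos : ∀ x : ℝ, |x| ≤ Real.pi / 2 - η → Real.sin η ≤ |Real.cos x| := by
    intro x hx
    rw [← Real.cos_abs x, ← Real.cos_pi_div_two_sub]
    refine le_trans ?_ (le_abs_self _)
    exact Real.cos_le_cos_of_nonneg_of_le_pi (abs_nonneg x) (by linarith) hx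
  have hsin : ∀ x : ℝ, η ≤ |x| → |x| ≤ Real.pi / 2 → Real.sin η ≤ |Real.sin x| := by
    intro x hx hx'
    rw [Real.abs_sin_eq_sin_abs_of_abs_le_pi (by linarith)]
    exact Real.sin_le_sin_of_le_of_le_pi_div_two (by linarith) hx' hx
  have hkey : ∀ θ ∈ Set.Icc 0 (Real.pi / 2), |α - θ| ≤ Real.pi / 2 - η := by
    intro θ hθ
    rw [abs_le]; constructor <;> linarith [hθ.1, hθ.2]
  rcases hθ with ((hθ | rfl) | ⟨θ, hθ', rfl⟩) | rfl
  · exact hcos _ (hkey θ (hΩ hθ))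
  · exact hcos _ (hkey 0 ⟨le_rfl, by positivity⟩)
  · simp only
    rw [← sub_sub, Real.cos_sub_pi_div_two]
    refine hsin _ (hdist θ (Or.inl (Or.inl (Or.inl hθ')))) ?_
    linarith [hkey θ (hΩ hθ')]
  · rw [Real.cos_sub_pi_div_two]
    refine hsin α ?_ ?_ <;> rw [abs_of_nonneg hα.1]
    · exact h0
    · exact hα.2

/-- Existence of good angles for a set of directions with coverings by `O(L / φ L)` intervals of
length `φ L`. -/
theorem exists_isGoodAngle {Ω : Set ℝ} (hΩ : Ω ⊆ Set.Icc 0 (Real.pi / 2)) {φ : ℝ → ℝ} {L₀ : ℝ}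
    (hL₀ : 0 < L₀) (hφ : ∀ L, 0 < L → L ≤ L₀ → 0 < φ L)
    (hmono : ∀ L L', 0 < L → L ≤ L' → L' ≤ L₀ → φ L ≤ φ L')
    (hcov : ∀ L, 0 < L → L ≤ L₀ → ∃ F : Finset ℝ, CoveredBy (enlarge Ω) (φ L) F ∧
      12 * ((F.card : ℝ) + 1) * φ L ≤ L) {g : ℕ → ℝ}
    (hg : ∀ c₀, 0 < c₀ → c₀ ≤ L₀ → ∃ c > 0, ∀ q : ℕ, 1 ≤ q → c * g q ≤ φ (φ (c₀ / q ^ 2))) :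
    ∃ α ∈ Set.Icc 0 (Real.pi / 2), IsGoodAngle Ω g α := by
  have hφle : ∀ L, 0 < L → L ≤ L₀ → 12 * φ L ≤ L := by
    intro L h1 h2
    obtain ⟨F, -, hF⟩ := hcov L h1 h2
    have := hφ L h1 h2
    nlinarith [mul_nonneg (Nat.cast_nonneg (α := ℝ) F.card) this.le]
  -- an initial interval away from the set of directions
  obtain ⟨b, η, hη, hb0, hb1, hbdist⟩ : ∃ b η : ℝ, 0 < η ∧ 0 ≤ b ∧ b + η ≤ 1 ∧
      ∀ α ∈ Set.Icc b (b + η), ∀ θ ∈ enlarge Ω, η ≤ |α - θ| := by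
    set L := min L₀ 1 with hL
    have hLpos : 0 < L := lt_min hL₀ one_pos
    have hLle : L ≤ L₀ := min_le_left _ _
    obtain ⟨F, hF, hFc⟩ := hcov L hLpos hLle
    have hℓ := hφ L hLpos hLle
    obtain ⟨b, h1, h2, h3⟩ := exists_subinterval_forall_not (a := 0) hℓ hFc
      (fun x α => ∃ θ, x ≤ θ ∧ θ ≤ x + φ L ∧ |α - θ| < φ L) (by
        rintro x - α - β - ⟨θ, h1, h2, h3⟩ ⟨θ', h1', h2', h3'⟩
        rw [abs_lt] at *
        rw [abs_le]
        constructor <;> linarith)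
    refine ⟨b, φ L, hℓ, h1, ?_, ?_⟩
    · have : L ≤ 1 := min_le_right _ _
      linarith
    · intro α hα θ hθ
      obtain ⟨x, hx, hx1, hx2⟩ := hF θ hθ
      by_contra hlt
      exact h3 x hx α hα ⟨θ, hx1, hx2, not_le.1 hlt⟩
  have hη1 : η ≤ 1 := by linarith
  have hpi := Real.pi_gt_three
  set κ := Real.sin η with hκ
  have hκ0 : 0 < κ := Real.sin_pos_of_pos_of_lt_pi hη (by linarith)
  have hκ1 : κ ≤ 1 := Real.sin_le_one _
  have hκ2 : κ ^ 2 ≤ 1 := pow_le_one₀ hκ0.le hκ1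
  have hcos : ∀ α ∈ Set.Icc b (b + η), ∀ θ ∈ enlarge Ω, κ ≤ |Real.cos (α - θ)| := by
    intro α hα θ hθ
    exact sin_le_abs_cos_sub hΩ hη.le ⟨hb0.trans hα.1, by linarith [hα.2]⟩ (hbdist α hα) hθ
  -- the lengths of the nested intervals
  set L₁ := min L₀ (min η (1 / 2)) with hL₁
  have hL₁0 : 0 < L₁ := lt_min hL₀ (lt_min hη (by norm_num))
  have hL₁L₀ : L₁ ≤ L₀ := min_le_left _ _
  have hL₁η : L₁ ≤ η := (min_le_right _ _).trans (min_le_left _ _)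
  have hL₁half : L₁ ≤ 1 / 2 := (min_le_right _ _).trans (min_le_right _ _)
  set L : ℕ → ℝ := fun k => φ^[k] L₁ with hLdef
  have hLs : ∀ k, L (k + 1) = φ (L k) := fun k => Function.iterate_succ_apply' φ k L₁
  have hL0 : L 0 = L₁ := rfl
  have hLk : ∀ k, 0 < L k ∧ L k ≤ L₁ ∧ L k ≤ (1 / 12) ^ k := by
    intro k
    induction k with
    | zero => exact ⟨hL₁0, le_rfl, by rw [hL0]; norm_num; linarith⟩
    | succ k ih =>
      have h1 := hφle (L k) ih.1 (ih.2.1.trans hL₁L₀)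
      rw [hLs]
      refine ⟨hφ _ ih.1 (ih.2.1.trans hL₁L₀), by linarith [ih.1, ih.2.1], ?_⟩
      rw [pow_succ]; linarith [ih.2.2]
  -- Two fractions dangerous for one cell are at most 4 L_k/κ² apart: 2 L_k/κ² from the variation of
  -- the tangent, the rest from the two approximation errors. The factor κ²/4 forces them to
  -- coincide.
  set c₀ := min (κ ^ 2 / 4) L₁ with hc₀
  have hc₀0 : 0 < c₀ := lt_min (by positivity) hL₁0
  have hc₀κ : c₀ ≤ κ ^ 2 / 4 := min_le_left _ _
  have hc₀L : c₀ ≤ L₁ := min_le_right _ _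
  obtain ⟨c, hc, hcg⟩ := hg c₀ hc₀0 (hc₀L.trans hL₁L₀)
  -- at stage `k` the denominators with `q ^ 2 * L k < c₀` are treated
  set Bad : ℕ → ℝ → Prop := fun k α => ∃ θ ∈ enlarge Ω, ∃ p : ℤ, ∃ q : ℕ, 1 ≤ q ∧
    (q : ℝ) ^ 2 * L k < c₀ ∧ c * g q ≤ L (k + 1) ∧ |Real.tan (α - θ) - p / q| ≤ c * g q with hBad
  obtain ⟨α, hα, hαgood⟩ : ∃ α ∈ Set.Icc b (b + L 0), ∀ k, ¬ Bad k α := by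
    refine exists_forall_not_of_nested (fun k => (hLk k).1.le) Bad fun k a ha ha' => ?_
    obtain ⟨hk0, hk1, -⟩ := hLk k
    have hk0' := (hLk (k + 1)).1
    obtain ⟨F, hF, hFc⟩ := hcov (L k) hk0 (hk1.trans hL₁L₀)
    have hle := hφle (L k) hk0 (hk1.trans hL₁L₀)
    rw [← hLs] at hF hFc hle
    obtain ⟨b', h1, h2, h3⟩ := exists_subinterval_forall_not (a := a) hk0' hFc
      (fun x α => ∃ θ ∈ enlarge Ω, x ≤ θ ∧ θ ≤ x + L (k + 1) ∧ ∃ p : ℤ, ∃ q : ℕ, 1 ≤ q ∧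
        (q : ℝ) ^ 2 * L k < c₀ ∧ c * g q ≤ L (k + 1) ∧ |Real.tan (α - θ) - p / q| ≤ c * g q) (by
      rintro x - α hα β hβ ⟨θ, hθ, h1, h2, p, q, hq, hqk, hqg, hpq⟩
        ⟨θ', hθ', h1', h2', p', q', hq', hqk', hqg', hpq'⟩
      have hαI : α ∈ Set.Icc b (b + η) := ⟨ha.trans hα.1, by linarith [hα.2]⟩
      have hβI : β ∈ Set.Icc b (b + η) := ⟨ha.trans hβ.1, by linarith [hβ.2]⟩
      have c1 := hcos α hαI θ hθ
      have c2 := hcos β hβI θ' hθ'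
      have hd : |(α - θ) - (β - θ')| ≤ L k + L (k + 1) := by
        rw [abs_le]
        constructor <;> linarith [hα.1, hα.2, hβ.1, hβ.2]
      have hd1 := abs_tan_sub_tan_le hκ0 c1 c2
      have hpp : (p : ℝ) / q = p' / q' := by
        have hx : ∀ q : ℕ, (q : ℝ) ^ 2 * L k < c₀ → (q : ℝ) ^ 2 * (4 * L k / κ ^ 2) < 1 := by
          intro q hqk
          have e1 : (q : ℝ) ^ 2 * (4 * L k / κ ^ 2) = (q ^ 2 * L k) * (4 / κ ^ 2) := by ring
          rw [e1]
          calc ((q : ℝ) ^ 2 * L k) * (4 / κ ^ 2) < (κ ^ 2 / 4) * (4 / κ ^ 2) := by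
                gcongr; linarith
            _ = 1 := by field_simp
        refine int_div_nat_eq_of_abs_sub_lt hq hq' (hx q hqk) (hx q' hqk') ?_
        have hd2 : |(α - θ) - (β - θ')| / κ ^ 2 ≤ 2 * L k / κ ^ 2 := by
          gcongr; linarith
        have hd3 : 2 * L k ≤ 2 * L k / κ ^ 2 := le_div_self (by positivity) (by positivity) hκ2
        have hd4 : 4 * L k / κ ^ 2 = 2 * L k / κ ^ 2 + 2 * L k / κ ^ 2 := by ring
        rw [abs_le] at *
        constructor <;> linarith
      -- Both tangents are close to the same fraction. Inverting the tangent gives 4 L_{k+1}, and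
      -- the cell length adds one more: the factor 5 of the pigeonhole lemma.
      have ht : |Real.tan (α - θ) - Real.tan (β - θ')| ≤ 2 * L (k + 1) := by
        rw [hpp] at hpq
        rw [abs_le] at *
        constructor <;> linarith
      have hs := abs_sub_le_two_mul_abs_tan_sub_tan (abs_pos.1 (hκ0.trans_le c1))
        (abs_pos.1 (hκ0.trans_le c2)) (by linarith)
      have hs' : |(α - θ) - (β - θ')| ≤ 4 * L (k + 1) := by linarith
      rw [abs_le] at *
      constructor <;> linarith)
    refine ⟨b', h1, h2, ?_⟩
    rintro α hα ⟨θ, hθ, hrest⟩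
    obtain ⟨x, hx, hx1, hx2⟩ := hF θ hθ
    exact h3 x hx α hα ⟨θ, hθ, hx1, hx2, hrest⟩
  refine ⟨α, ⟨hb0.trans hα.1, by linarith [hα.2]⟩, c, hc, fun θ hθ p q hq => ?_⟩
  have hqR : (1 : ℝ) ≤ q := by exact_mod_cast hq
  have hex : ∃ k, (q : ℝ) ^ 2 * L k < c₀ := by
    obtain ⟨k, hk⟩ := exists_pow_lt_of_lt_one (show 0 < c₀ / (q : ℝ) ^ 2 by positivity)
      (show (1 / 12 : ℝ) < 1 by norm_num)
    refine ⟨k, ?_⟩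
    have := ((hLk k).2.2).trans_lt hk
    rwa [lt_div_iff₀' (by positivity)] at this
  classical
  -- By minimality L_{k-1} ≥ c₀/q² when k > 0, so L_{k+1} dominates the second iterate of φ at
  -- c₀/q². For k = 0 this follows from c₀ ≤ L₁ and monotonicity.
  set k := Nat.find hex with hk
  have hkq : (q : ℝ) ^ 2 * L k < c₀ := Nat.find_spec hex
  have hdiv : c₀ / (q : ℝ) ^ 2 ≤ c₀ := div_le_self hc₀0.le (one_le_pow₀ hqR)
  have hdiv0 : 0 < c₀ / (q : ℝ) ^ 2 := by positivity
  have hstage : c * g q ≤ L (k + 1) := by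
    refine (hcg q hq).trans ?_
    rcases Nat.eq_zero_or_pos k with h0 | hpos
    · rw [h0, hLs, hL0]
      have h1 := hφ _ hdiv0 (hdiv.trans (hc₀L.trans hL₁L₀))
      have h2 := hφle _ hdiv0 (hdiv.trans (hc₀L.trans hL₁L₀))
      exact hmono _ _ h1 (by linarith) hL₁L₀
    · obtain ⟨j, hj⟩ : ∃ j, k = j + 1 := ⟨k - 1, by omega⟩
      have hnot : ¬ (q : ℝ) ^ 2 * L j < c₀ := Nat.find_min hex (by omega)
      have hle : c₀ / (q : ℝ) ^ 2 ≤ L j := by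
        rw [div_le_iff₀' (by positivity)]; exact not_lt.1 hnot
      obtain ⟨-, hj1, -⟩ := hLk j
      obtain ⟨-, hj2, -⟩ := hLk (j + 1)
      rw [hj, hLs, hLs]
      rw [hLs] at hj2
      exact hmono _ _ (hφ _ hdiv0 (hle.trans (hj1.trans hL₁L₀)))
        (hmono _ _ hdiv0 hle (hj1.trans hL₁L₀)) (hj2.trans hL₁L₀)
  by_contra hcon
  exact hαgood k ⟨θ, hθ, p, q, hq, hkq, hstage, not_lt.1 hcon⟩

end DirDisc

/-! ### Covering numbers of lacunary sets. -/

namespace DirDisc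
open Finset

lemma CoveredBy.enlarge {Ω : Set ℝ} {δ : ℝ} {F : Finset ℝ} (h : CoveredBy Ω δ F) (hδ : 0 ≤ δ) :
    ∃ F' : Finset ℝ, CoveredBy (enlarge Ω) δ F' ∧ (F'.card : ℝ) ≤ 2 * F.card + 2 := by
  classical
  refine ⟨(F ∪ {0, Real.pi / 2}) ∪ F.image (· + Real.pi / 2), ?_, ?_⟩
  · rintro θ (((hθ | rfl) | ⟨θ, hθ, rfl⟩) | rfl)
    · obtain ⟨x, hx, h1⟩ := h θ hθ
      exact ⟨x, by simp [hx], h1⟩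
    · exact ⟨0, by simp, le_rfl, by simpa using hδ⟩
    · obtain ⟨x, hx, h1, h2⟩ := h θ hθ
      refine ⟨x + Real.pi / 2, mem_union_right _ (mem_image_of_mem _ hx), ?_, ?_⟩ <;>
        simp only <;> linarith
    · exact ⟨Real.pi / 2, by simp, le_rfl, by simpa using hδ⟩
  · have h1 := card_union_le (F ∪ {0, Real.pi / 2}) (F.image (· + Real.pi / 2))
    have h2 := card_union_le F {0, Real.pi / 2}
    have h3 : (F.image (· + Real.pi / 2)).card ≤ F.card := card_image_le
    have h4 : ({0, Real.pi / 2} : Finset ℝ).card ≤ 2 := card_le_two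
    have : ((F ∪ {0, Real.pi / 2}) ∪ F.image (· + Real.pi / 2)).card ≤ 2 * F.card + 2 := by omega
    exact_mod_cast this

lemma LacunaryWith.mono {A A' : ℝ} {ω : ℕ → ℝ} (h : LacunaryWith A ω) (hA : A ≤ A') :
    LacunaryWith A' ω := fun n => ⟨(h n).1, (h n).2.trans_le hA⟩

lemma LacunaryWith.add_le {A : ℝ} {ω : ℕ → ℝ} (h : LacunaryWith A ω) (hA : 0 ≤ A) (n k : ℕ) :
    ω (n + k) ≤ A ^ k * ω n := by
  induction k with
  | zero => simp
  | succ k ih =>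
    have h1 := (h (n + k)).2
    rw [div_lt_iff₀ (h (n + k)).1] at h1
    calc ω (n + (k + 1)) ≤ A * ω (n + k) := h1.le
      _ ≤ A * (A ^ k * ω n) := by gcongr
      _ = _ := by ring

lemma LacunaryWith.le_zero {A : ℝ} {ω : ℕ → ℝ} (h : LacunaryWith A ω) (hA : 0 ≤ A) (hA1 : A ≤ 1)
    (n : ℕ) : ω n ≤ ω 0 := by
  have h1 := h.add_le hA 0 n
  rw [zero_add] at h1
  refine h1.trans ?_
  have h2 : A ^ n ≤ 1 := pow_le_one₀ hA hA1
  exact mul_le_of_le_one_left (h 0).1.le h2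

lemma one_le_logb_two_one_div {δ : ℝ} (hδ : 0 < δ) (hδ' : δ ≤ 1 / 2) :
    1 ≤ Real.logb 2 (1 / δ) := by
  rw [Real.le_logb_iff_rpow_le (by norm_num) (by positivity), Real.rpow_one,
    le_div_iff₀ hδ]
  linarith

/-- A lacunary sequence has `O(log (1 / δ))` terms in `(δ, D]`. -/
lemma exists_finset_lacunary {A : ℝ} (hA0 : 0 < A) (hA1 : A < 1) (D : ℝ) :
    ∃ K > 0, ∀ δ : ℝ, 0 < δ → δ ≤ 1 / 2 → ∀ ω, LacunaryWith A ω → ∃ F : Finset ℝ,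
      (F.card : ℝ) ≤ K * Real.logb 2 (1 / δ) ∧ ∀ n, δ < ω n → ω n ≤ D → ω n ∈ F := by
  set E := max D 1 with hE
  have hE1 : 1 ≤ E := le_max_right _ _
  have hlam : 0 < -Real.log A := by linarith [Real.log_neg hA0 hA1]
  have hlE : 0 ≤ Real.log E := Real.log_nonneg hE1
  refine ⟨(Real.log E + 1) / (-Real.log A) + 1, by positivity, fun δ hδ hδ' ω hω => ?_⟩
  have hy := one_le_logb_two_one_div hδ hδ'
  set y := Real.logb 2 (1 / δ) with hydef
  by_cases hex : ∃ n, δ < ω n ∧ ω n ≤ D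
  · classical
    -- From the first term in (δ, D] on, the decay is at least geometric, so fewer than
    -- log(E/δ)/log(1/A) + 1 indices can stay above δ. The bound does not depend on ω.
    set n₀ := Nat.find hex with hn₀
    obtain ⟨h1, h2⟩ : δ < ω n₀ ∧ ω n₀ ≤ D := Nat.find_spec hex
    set X := (Real.log E - Real.log δ) / (-Real.log A) with hX
    have hlogδ : -Real.log δ ≤ y := by
      have hlog2 : Real.log 2 ≤ 1 := by
        have := Real.log_two_lt_d9; linarith
      have hlog2' : 0 < Real.log 2 := Real.log_pos (by norm_num)
      have : -Real.log δ = y * Real.log 2 := by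
        rw [hydef, Real.logb, one_div, Real.log_inv, div_mul_cancel₀ _ hlog2'.ne']
      rw [this]
      exact mul_le_of_le_one_right (by linarith) hlog2
    have hX0 : 0 ≤ X := by
      have : Real.log δ ≤ 0 := Real.log_nonpos hδ.le (by linarith)
      exact div_nonneg (by linarith) hlam.le
    refine ⟨(range ⌈X⌉₊).image (fun i => ω (n₀ + i)), ?_, ?_⟩
    · have hc : (((range ⌈X⌉₊).image (fun i => ω (n₀ + i))).card : ℝ) ≤ ⌈X⌉₊ := by
        have := card_image_le (s := range ⌈X⌉₊) (f := fun i => ω (n₀ + i))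
        rw [card_range] at this
        exact_mod_cast this
      have hc2 := Nat.ceil_lt_add_one hX0
      have hXy : X ≤ (Real.log E + 1) / (-Real.log A) * y := by
        rw [hX, div_mul_eq_mul_div]
        gcongr
        nlinarith
      rw [add_mul]
      linarith
    · intro n hn1 hn2
      have hle : n₀ ≤ n := Nat.find_min' hex ⟨hn1, hn2⟩
      obtain ⟨i, rfl⟩ := Nat.exists_eq_add_of_le hle
      refine mem_image_of_mem (fun i => ω (n₀ + i)) (mem_range.2 (Nat.lt_ceil.2 ?_))
      have h3 := hω.add_le hA0.le n₀ i
      have h4 : δ < A ^ i * E := by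
        refine hn1.trans_le (h3.trans ?_)
        gcongr
        exact h2.trans (le_max_left _ _)
      have h5 := Real.log_lt_log hδ h4
      rw [Real.log_mul (by positivity) (by positivity), Real.log_pow] at h5
      rw [hX, lt_div_iff₀ hlam]
      linarith
  · push Not at hex
    refine ⟨∅, ?_, fun n h1 h2 => absurd (hex n h1) (not_lt.2 h2)⟩
    simp only [card_empty, Nat.cast_zero]
    positivity

/-- The first terms `r a 0`, `l a 0` are not uniformly bounded in a. By the gap condition, however,
only a greatest or least point of Ω' can carry terms outside the range of Ω', so only two sequences
matter. -/
lemma IsLacunaryOfOrder.bounded {M : ℕ} {Ω : Set ℝ} (h : IsLacunaryOfOrder M Ω) :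
    ∃ B, ∀ x ∈ Ω, |x| ≤ B := by
  induction h with
  | one Ω ω hω hΩ =>
    obtain ⟨A, hA, hω⟩ := hω
    refine ⟨ω 0, fun x hx => ?_⟩
    obtain ⟨n, rfl⟩ := hΩ hx
    have hω' := hω.mono (le_max_left A 0)
    rw [abs_of_pos (hω n).1]
    exact hω'.le_zero (le_max_right _ _) (max_le hA.le zero_le_one) n
  | succ M Ω Ω' hΩ' A hA r l hr hl hcover ih =>
    obtain ⟨B, hB⟩ := ih
    have hA0 : 0 ≤ max A 0 := le_max_right _ _
    have hA1 : max A 0 ≤ 1 := max_le hA.le zero_le_one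
    have hr' : ∀ a ∈ Ω', ∀ n, 0 < r a n ∧ r a n ≤ r a 0 := fun a ha n =>
      ⟨((hr a ha) n).1, ((hr a ha).mono (le_max_left A 0)).le_zero hA0 hA1 n⟩
    have hl' : ∀ a ∈ Ω', ∀ n, 0 < l a n ∧ l a n ≤ l a 0 := fun a ha n =>
      ⟨((hl a ha) n).1, ((hl a ha).mono (le_max_left A 0)).le_zero hA0 hA1 n⟩
    obtain ⟨Br, hBr0, hBr⟩ : ∃ Br, 0 ≤ Br ∧ ∀ a, IsGreatest Ω' a → r a 0 ≤ Br := by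
      by_cases h : ∃ a, IsGreatest Ω' a
      · obtain ⟨a, ha⟩ := h
        exact ⟨r a 0, (hr' a ha.1 0).1.le, fun b hb => by rw [hb.unique ha]⟩
      · exact ⟨0, le_rfl, fun a ha => absurd ⟨a, ha⟩ h⟩
    obtain ⟨Bl, hBl0, hBl⟩ : ∃ Bl, 0 ≤ Bl ∧ ∀ a, IsLeast Ω' a → l a 0 ≤ Bl := by
      by_cases h : ∃ a, IsLeast Ω' a
      · obtain ⟨a, ha⟩ := h
        exact ⟨l a 0, (hl' a ha.1 0).1.le, fun b hb => by rw [hb.unique ha]⟩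
      · exact ⟨0, le_rfl, fun a ha => absurd ⟨a, ha⟩ h⟩
    refine ⟨B + Br + Bl, fun x hx => ?_⟩
    rcases hcover x hx with hx' | ⟨a, ha, (⟨n, rfl⟩ | ⟨n, rfl⟩), hgap⟩
    · linarith [hB x hx']
    · have haB := abs_le.1 (hB a ha)
      obtain ⟨hp, hle⟩ := hr' a ha n
      have hub : a + r a n ≤ B + Br := by
        by_cases hg : IsGreatest Ω' a
        · linarith [hBr a hg]
        · have : ∃ b ∈ Ω', a < b := by
            by_contra! hcon; exact hg ⟨ha, fun b hb => hcon b hb⟩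
          obtain ⟨b, hb, hab⟩ := this
          have h1 := hgap b hb
          rw [min_eq_left (by linarith), max_eq_right (by linarith), Set.mem_Ioo, not_and,
            not_lt] at h1
          linarith [h1 hab, (abs_le.1 (hB b hb)).2]
      rw [abs_le]; constructor <;> linarith
    · have haB := abs_le.1 (hB a ha)
      obtain ⟨hp, hle⟩ := hl' a ha n
      have hub : -(B + Bl) ≤ a - l a n := by
        by_cases hg : IsLeast Ω' a
        · linarith [hBl a hg]
        · have : ∃ b ∈ Ω', b < a := by
            by_contra! hcon; exact hg ⟨ha, fun b hb => hcon b hb⟩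
          obtain ⟨b, hb, hab⟩ := this
          have h1 := hgap b hb
          rw [min_eq_right (by linarith), max_eq_left (by linarith), Set.mem_Ioo, not_and',
            not_lt] at h1
          linarith [h1 hab, (abs_le.1 (hB b hb)).1]
      rw [abs_le]; constructor <;> linarith

/-- Points of a set of order `M + 1` which belong to points of `Ω'` in one interval of length `δ`
are covered by the terms of two lacunary sequences and three intervals. -/
lemma exists_finset_cell {Ω' : Set ℝ} {A D K δ : ℝ} {r l : ℝ → ℕ → ℝ}
    (hr : ∀ a ∈ Ω', LacunaryWith A (r a)) (hl : ∀ a ∈ Ω', LacunaryWith A (l a)) (hδ : 0 < δ)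
    (hK : ∀ ω, LacunaryWith A ω → ∃ F : Finset ℝ,
      (F.card : ℝ) ≤ K ∧ ∀ n, δ < ω n → ω n ≤ D → ω n ∈ F) (hK0 : 0 ≤ K) (x : ℝ) :
    ∃ G : Finset ℝ, (G.card : ℝ) ≤ 3 + 2 * K ∧ ∀ a ∈ Ω', x ≤ a → a ≤ x + δ → ∀ z, |z - a| ≤ D →
      (z = a ∨ ((∃ n, z = a + r a n) ∨ (∃ n, z = a - l a n)) ∧
        ∀ b ∈ Ω', b ∉ Set.Ioo (min a z) (max a z)) → ∃ w ∈ G, w ≤ z ∧ z ≤ w + δ := by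
  classical
  -- Terms at distance more than δ to the right can belong only to the greatest point of `J`: any
  -- larger point of `J` would lie strictly between. On the left the same holds for the least point.
  -- Hence two sequences suffice, however many points `J` has.
  set J := {a | a ∈ Ω' ∧ x ≤ a ∧ a ≤ x + δ} with hJ
  obtain ⟨Fr, hFr, hFr'⟩ : ∃ F : Finset ℝ, (F.card : ℝ) ≤ K ∧ ∀ a, IsGreatest J a →
      ∀ n, δ < r a n → r a n ≤ D → a + r a n ∈ F := by
    by_cases h : ∃ a, IsGreatest J a
    · obtain ⟨a, ha⟩ := h
      obtain ⟨F, hF, hF'⟩ := hK (r a) (hr a ha.1.1)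
      refine ⟨F.image (a + ·), ?_, fun b hb n h1 h2 => ?_⟩
      · exact le_trans (by exact_mod_cast card_image_le) hF
      · rw [hb.unique ha] at *
        exact mem_image_of_mem _ (hF' n h1 h2)
    · exact ⟨∅, by simpa using hK0, fun a ha => absurd ⟨a, ha⟩ h⟩
  obtain ⟨Fl, hFl, hFl'⟩ : ∃ F : Finset ℝ, (F.card : ℝ) ≤ K ∧ ∀ a, IsLeast J a →
      ∀ n, δ < l a n → l a n ≤ D → a - l a n ∈ F := by
    by_cases h : ∃ a, IsLeast J a
    · obtain ⟨a, ha⟩ := h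
      obtain ⟨F, hF, hF'⟩ := hK (l a) (hl a ha.1.1)
      refine ⟨F.image (a - ·), ?_, fun b hb n h1 h2 => ?_⟩
      · exact le_trans (by exact_mod_cast card_image_le) hF
      · rw [hb.unique ha] at *
        exact mem_image_of_mem _ (hF' n h1 h2)
    · exact ⟨∅, by simpa using hK0, fun a ha => absurd ⟨a, ha⟩ h⟩
  refine ⟨({x - δ, x, x + δ} ∪ Fr) ∪ Fl, ?_, ?_⟩
  · have h1 := card_union_le ({x - δ, x, x + δ} ∪ Fr) Fl
    have h2 := card_union_le {x - δ, x, x + δ} Fr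
    have h3 : ({x - δ, x, x + δ} : Finset ℝ).card ≤ 3 := card_le_three
    have : ((({x - δ, x, x + δ} ∪ Fr) ∪ Fl).card : ℝ) ≤ 3 + Fr.card + Fl.card := by
      exact_mod_cast (by omega)
    linarith
  · intro a ha hxa hax z hzD hz
    -- Near points lie in [x - δ, x + 2δ], which takes three intervals.
    by_cases hnear : |z - a| ≤ δ
    · rw [abs_le] at hnear
      rcases le_total z x with h1 | h1
      · exact ⟨x - δ, by simp, by linarith, by linarith⟩
      rcases le_total z (x + δ) with h2 | h2
      · exact ⟨x, by simp, h1, h2⟩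
      · exact ⟨x + δ, by simp, h2, by linarith⟩
    · rcases hz with rfl | ⟨⟨n, rfl⟩ | ⟨n, rfl⟩, hgap⟩
      · simp [hδ.le] at hnear
      · have hpos := (hr a ha n).1
        rw [add_sub_cancel_left, abs_of_pos hpos] at hnear hzD
        have hgr : IsGreatest J a := by
          refine ⟨⟨ha, hxa, hax⟩, fun b hb => ?_⟩
          by_contra! hab
          have h1 := hgap b hb.1
          rw [min_eq_left (by linarith), max_eq_right (by linarith), Set.mem_Ioo, not_and,
            not_lt] at h1
          linarith [h1 hab, hb.2.2]
        refine ⟨_, mem_union_left _ (mem_union_right _ (hFr' a hgr n (by linarith) hzD)),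
          le_rfl, by linarith⟩
      · have hpos := (hl a ha n).1
        have e : a - l a n - a = -l a n := by ring
        rw [e, abs_neg, abs_of_pos hpos] at hnear hzD
        have hgr : IsLeast J a := by
          refine ⟨⟨ha, hxa, hax⟩, fun b hb => ?_⟩
          by_contra! hab
          have h1 := hgap b hb.1
          rw [min_eq_right (by linarith), max_eq_left (by linarith), Set.mem_Ioo, not_and',
            not_lt] at h1
          linarith [h1 hab, hb.2.1]
        refine ⟨_, mem_union_right _ (hFl' a hgr n (by linarith) hzD), le_rfl, by linarith⟩

/-- A lacunary set of order `M` is covered by `O(log (1 / δ) ^ M)` intervals of length `δ`. -/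
theorem IsLacunaryOfOrder.exists_coveredBy {M : ℕ} {Ω : Set ℝ} (h : IsLacunaryOfOrder M Ω) :
    ∃ C > 0, ∀ δ : ℝ, 0 < δ → δ ≤ 1 / 2 → ∃ F : Finset ℝ, CoveredBy Ω δ F ∧
      (F.card : ℝ) ≤ C * Real.logb 2 (1 / δ) ^ M := by
  classical
  induction h with
  | one Ω ω hω hΩ =>
    obtain ⟨A, hA, hω⟩ := hω
    have hA0 : 0 < A := (div_pos (hω 1).1 (hω 0).1).trans (hω 0).2
    obtain ⟨K, hK, hKF⟩ := exists_finset_lacunary hA0 hA (ω 0)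
    refine ⟨K + 1, by positivity, fun δ hδ hδ' => ?_⟩
    obtain ⟨F, hF, hF'⟩ := hKF δ hδ hδ' ω hω
    have hy := one_le_logb_two_one_div hδ hδ'
    -- The interval starting at 0 takes all terms up to δ.
    refine ⟨insert 0 F, fun θ hθ => ?_, ?_⟩
    · obtain ⟨n, rfl⟩ := hΩ hθ
      rcases le_or_gt (ω n) δ with h | h
      · exact ⟨0, by simp, (hω n).1.le, by linarith⟩
      · exact ⟨ω n, mem_insert_of_mem (hF' n h (hω.le_zero hA0.le hA.le n)), le_rfl,
          by linarith⟩
    · have : ((insert 0 F).card : ℝ) ≤ F.card + 1 := by exact_mod_cast card_insert_le 0 F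
      rw [pow_one, add_mul]
      linarith
  | succ M Ω Ω' hΩ' A hA r l hr hl hcover ih =>
    obtain ⟨C, hC, hCF⟩ := ih
    obtain ⟨B, hB⟩ := (IsLacunaryOfOrder.succ M Ω Ω' hΩ' A hA r l hr hl hcover).bounded
    obtain ⟨B', hB'⟩ := hΩ'.bounded
    -- If Ω' is empty, nothing forces A to be positive; the maximum with 1/2 does.
    have hA1 : max A (1 / 2) < 1 := max_lt hA (by norm_num)
    have hA0 : 0 < max A (1 / 2) := lt_max_of_lt_right (by norm_num)
    obtain ⟨K, hK, hKF⟩ := exists_finset_lacunary hA0 hA1 (B + B')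
    refine ⟨C * (3 + 2 * K), by positivity, fun δ hδ hδ' => ?_⟩
    have hy := one_le_logb_two_one_div hδ hδ'
    obtain ⟨F, hF, hFc⟩ := hCF δ hδ hδ'
    have hcell := fun x => exists_finset_cell (fun a ha => (hr a ha).mono (le_max_left A (1 / 2)))
      (fun a ha => (hl a ha).mono (le_max_left A (1 / 2))) hδ (hKF δ hδ hδ') (by positivity) x
    choose G hGc hG using hcell
    refine ⟨F.biUnion G, fun z hz => ?_, ?_⟩
    · obtain ⟨a, ha, hrel⟩ : ∃ a ∈ Ω', (z = a ∨
          ((∃ n, z = a + r a n) ∨ (∃ n, z = a - l a n)) ∧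
            ∀ b ∈ Ω', b ∉ Set.Ioo (min a z) (max a z)) := by
        rcases hcover z hz with h | ⟨a, ha, h⟩
        · exact ⟨z, h, Or.inl rfl⟩
        · exact ⟨a, ha, Or.inr h⟩
      obtain ⟨x, hx, hx1, hx2⟩ := hF a ha
      obtain ⟨w, hw, hw'⟩ := hG x a ha hx1 hx2 z
        ((abs_sub _ _).trans (add_le_add (hB z hz) (hB' a ha))) hrel
      exact ⟨w, mem_biUnion.2 ⟨x, hx, hw⟩, hw'⟩
    · set y := Real.logb 2 (1 / δ)
      calc ((F.biUnion G).card : ℝ) ≤ ∑ x ∈ F, ((G x).card : ℝ) := by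
            exact_mod_cast card_biUnion_le
        _ ≤ ∑ x ∈ F, (3 + 2 * (K * y)) := sum_le_sum fun x _ => hGc x
        _ = F.card * (3 + 2 * (K * y)) := by rw [sum_const, nsmul_eq_mul]
        _ ≤ (C * y ^ M) * ((3 + 2 * K) * y) := by
            gcongr
            linarith
        _ = _ := by ring

end DirDisc

/-! ### Good angles for lacunary sets and for sets of small dimension. -/

namespace DirDisc
open Finset

theorem exists_isGoodAngle_of_isLacunaryOfOrder {M : ℕ} {Ω : Set ℝ} (hM : IsLacunaryOfOrder M Ω)
    (hΩ : Ω ⊆ Set.Icc 0 (Real.pi / 2)) :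
    ∃ α ∈ Set.Icc 0 (Real.pi / 2),
      IsGoodAngle Ω (fun q => 1 / ((q : ℝ) ^ 2 * clog q ^ (2 * M))) α := by
  obtain ⟨C, hC, hcov⟩ := hM.exists_coveredBy
  -- Enlarging turns n cells into at most 2n + 2, and one more is needed for pigeonhole, whence 2C +
  -- 3. The power of M + 2 pays for replacing log(1/φ L) by log(1/L).
  set K : ℝ := 12 * (2 * C + 3) * ((M : ℝ) + 2) ^ M with hK
  have hK36 : 36 ≤ K := by
    have h1 : (1 : ℝ) ≤ ((M : ℝ) + 2) ^ M := one_le_pow₀ (by linarith [Nat.cast_nonneg (α := ℝ) M])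
    have h2 : 36 ≤ 12 * (2 * C + 3) := by linarith
    calc (36 : ℝ) = 36 * 1 := by ring
      _ ≤ 12 * (2 * C + 3) * ((M : ℝ) + 2) ^ M := by gcongr
  have hK0 : 0 < K := by linarith
  set y : ℝ → ℝ := fun L => Real.logb 2 (1 / L) with hy
  set φ : ℝ → ℝ := fun L => L / (K * y L ^ M) with hφ
  have hhalf : 1 / K ≤ 1 / 2 := one_div_le_one_div_of_le (by norm_num) (by linarith)
  have hy1 : ∀ L, 0 < L → L ≤ 1 / K → 1 ≤ y L := fun L h1 h2 =>
    one_le_logb_two_one_div h1 (h2.trans hhalf)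
  have hφpos : ∀ L, 0 < L → L ≤ 1 / K → 0 < φ L := by
    intro L h1 h2
    have := hy1 L h1 h2
    simp only [hφ]; positivity
  have hφle : ∀ L, 0 < L → L ≤ 1 / K → φ L ≤ L := by
    intro L h1 h2
    have h3 := hy1 L h1 h2
    refine div_le_self h1.le ?_
    have : 1 ≤ y L ^ M := one_le_pow₀ h3
    nlinarith
  -- One application of φ multiplies log(1/L) by a constant only, so two applications cost two
  -- factors log^M.
  have hyφ : ∀ L, 0 < L → L ≤ 1 / K → y (φ L) ≤ (M + 2) * y L := by
    intro L h1 h2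
    have h3 := hy1 L h1 h2
    have e1 : y (φ L) = Real.logb 2 K + M * Real.logb 2 (y L) + y L := by
      simp only [hφ]
      have : 1 / (L / (K * y L ^ M)) = K * y L ^ M * (1 / L) := by field_simp
      change Real.logb 2 (1 / (L / (K * y L ^ M))) = _
      rw [this, Real.logb_mul (by positivity) (by positivity),
        Real.logb_mul (by positivity) (by positivity), Real.logb_pow]
    have e2 : Real.logb 2 K ≤ y L := by
      refine Real.logb_le_logb_of_le (by norm_num) hK0 ?_
      rw [le_div_iff₀ h1]
      rw [le_div_iff₀ hK0] at h2
      linarith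
    have e3 : Real.logb 2 (y L) ≤ y L := by
      rw [Real.logb_le_iff_le_rpow (by norm_num) (by linarith)]
      have := one_add_mul_self_le_rpow_one_add (show (-1 : ℝ) ≤ 1 by norm_num) h3
      norm_num at this
      linarith
    have e4 : (M : ℝ) * Real.logb 2 (y L) ≤ M * y L := by gcongr
    rw [e1]; linarith
  refine exists_isGoodAngle hΩ (φ := φ) (L₀ := 1 / K) (by positivity) hφpos ?_ ?_ ?_
  · intro L L' h1 h2 h3
    have h4 := hy1 L' (h1.trans_le h2) h3
    have h5 : y L' ≤ y L := Real.logb_le_logb_of_le (by norm_num)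
      (one_div_pos.2 (h1.trans_le h2)) (one_div_le_one_div_of_le h1 h2)
    have h6 : 0 ≤ L' := (h1.trans_le h2).le
    simp only [hφ]
    gcongr
  · intro L h1 h2
    have h3 := hφpos L h1 h2
    have h4 := hφle L h1 h2
    have h5 := hy1 L h1 h2
    obtain ⟨F, hF, hFc⟩ := hcov (φ L) h3 (h4.trans (h2.trans hhalf))
    obtain ⟨F', hF', hFc'⟩ := hF.enlarge h3.le
    refine ⟨F', hF', ?_⟩
    have h6 : Real.logb 2 (1 / φ L) ^ M ≤ ((M + 2) * y L) ^ M := by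
      have h7 : 0 ≤ Real.logb 2 (1 / φ L) := by
        linarith [one_le_logb_two_one_div h3 (h4.trans (h2.trans hhalf))]
      have h8 : Real.logb 2 (1 / φ L) ≤ (M + 2) * y L := hyφ L h1 h2
      gcongr
    have h7 : (1 : ℝ) ≤ ((M + 2) * y L) ^ M :=
      one_le_pow₀ (by nlinarith [Nat.cast_nonneg (α := ℝ) M])
    have h8 : (F'.card : ℝ) + 1 ≤ (2 * C + 3) * ((M + 2) * y L) ^ M := by
      have : (F.card : ℝ) ≤ C * ((M + 2) * y L) ^ M := hFc.trans (by gcongr)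
      linarith
    calc 12 * ((F'.card : ℝ) + 1) * φ L ≤ 12 * ((2 * C + 3) * ((M + 2) * y L) ^ M) * φ L := by
          gcongr
      _ = K * y L ^ M * φ L := by rw [mul_pow, hK]; ring
      _ = L := by simp only [hφ]; rw [mul_div_cancel₀]; positivity
  · intro c₀ hc₀ hc₀K
    -- Here log(q²/c₀) = 2 log q + log(1/c₀) ≤ D · `clog q`, because `clog` is at least 1.
    set D : ℝ := 2 + y c₀ with hD
    have hD0 : 3 ≤ D := by linarith [hy1 c₀ hc₀ hc₀K]
    refine ⟨c₀ / (K ^ 2 * (M + 2) ^ M * D ^ (2 * M)), by positivity, fun q hq => ?_⟩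
    have hq' : (1 : ℝ) ≤ q := by exact_mod_cast hq
    have hclog := one_le_clog q
    set L := c₀ / (q : ℝ) ^ 2 with hL
    have hL0 : 0 < L := by positivity
    have hLK : L ≤ 1 / K := (div_le_self hc₀.le (one_le_pow₀ hq')).trans hc₀K
    have h1 := hy1 L hL0 hLK
    have hyL : y L ≤ D * clog q := by
      have e1 : y L = 2 * Real.logb 2 q + y c₀ := by
        have : 1 / L = (q : ℝ) ^ 2 * (1 / c₀) := by rw [hL]; field_simp
        change Real.logb 2 (1 / L) = _
        rw [this, Real.logb_mul (by positivity) (by positivity), Real.logb_pow]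
        norm_num [hy]
      have e2 : Real.logb 2 q ≤ clog q := le_max_right _ _
      have e3 := hy1 c₀ hc₀ hc₀K
      rw [e1, hD]
      nlinarith
    have h2 := hyφ L hL0 hLK
    have h3 := hφpos L hL0 hLK
    have h4 := hy1 (φ L) h3 ((hφle L hL0 hLK).trans hLK)
    have h5 : y (φ L) ≤ (M + 2) * (D * clog q) := h2.trans (by gcongr)
    calc c₀ / (K ^ 2 * (M + 2) ^ M * D ^ (2 * M)) * (1 / ((q : ℝ) ^ 2 * clog q ^ (2 * M)))
        = L / (K * (D * clog q) ^ M) / (K * ((M + 2) * (D * clog q)) ^ M) := by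
          clear_value K D
          rw [hL]
          simp only [mul_pow, pow_mul']
          field_simp
      _ ≤ L / (K * y L ^ M) / (K * y (φ L) ^ M) := by gcongr

/-- Makes the set of admissible exponents nonempty, so that the infimum defining the dimension can
be approached from above. -/
lemma coveredWithExponent_one {Ω : Set ℝ} (hΩ : Ω ⊆ Set.Icc 0 (Real.pi / 2)) :
    CoveredWithExponent Ω 1 := by
  classical
  refine ⟨3, 1, one_pos, fun δ hδ hδ1 => ?_⟩
  refine ⟨(range (⌊2 / δ⌋₊ + 1)).image (fun i : ℕ => (i : ℝ) * δ), ?_, fun θ hθ => ?_⟩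
  · have h1 : (((range (⌊2 / δ⌋₊ + 1)).image (fun i : ℕ => (i : ℝ) * δ)).card : ℝ) ≤
        ⌊2 / δ⌋₊ + 1 := by
      have := card_image_le (s := range (⌊2 / δ⌋₊ + 1)) (f := fun i : ℕ => (i : ℝ) * δ)
      rw [card_range] at this
      exact_mod_cast this
    have h2 := Nat.floor_le (show 0 ≤ 2 / δ by positivity)
    have h3 : 1 ≤ 1 / δ := by rw [le_div_iff₀ hδ]; linarith
    rw [Real.rpow_neg_one]
    calc _ ≤ (⌊2 / δ⌋₊ : ℝ) + 1 := h1
      _ ≤ 2 / δ + 1 / δ := by linarith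
      _ = 3 * δ⁻¹ := by ring
  · obtain ⟨h0, h1⟩ := hΩ hθ
    have hpi := Real.pi_le_four
    simp only [Set.mem_iUnion, mem_image, mem_range, exists_prop]
    refine ⟨⌊θ / δ⌋₊ * δ, ⟨⌊θ / δ⌋₊, ?_, rfl⟩, ?_, ?_⟩
    · refine Nat.lt_succ_of_le (Nat.floor_le_floor ?_)
      gcongr
      linarith
    · rw [← le_div_iff₀ hδ]
      exact Nat.floor_le (by positivity)
    · have := (Nat.lt_floor_add_one (θ / δ)).le
      rw [div_le_iff₀ hδ] at this
      linarith

lemma exists_coveredBy_of_upperMinkowskiDim_lt {Ω : Set ℝ} (hΩ : Ω ⊆ Set.Icc 0 (Real.pi / 2))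
    {s : ℝ} (hs : upperMinkowskiDim Ω < s) :
    ∃ C > 0, ∃ δ₀ > 0, δ₀ ≤ 1 ∧ ∀ δ : ℝ, 0 < δ → δ < δ₀ → ∃ F : Finset ℝ, CoveredBy Ω δ F ∧
      (F.card : ℝ) ≤ C * δ ^ (-s) := by
  rw [upperMinkowskiDim] at hs
  have hne : {s : ℝ | 0 ≤ s ∧ CoveredWithExponent Ω s}.Nonempty :=
    ⟨1, zero_le_one, coveredWithExponent_one hΩ⟩
  obtain ⟨t, ⟨ht0, C, δ₀, hδ₀, hcov⟩, hts⟩ := exists_lt_of_csInf_lt hne hs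
  refine ⟨max C 1, by positivity, min δ₀ 1, lt_min hδ₀ one_pos, min_le_right _ _,
    fun δ hδ hδ' => ?_⟩
  obtain ⟨F, hF, hFcov⟩ := hcov δ hδ (hδ'.trans_le (min_le_left _ _))
  refine ⟨F, fun θ hθ => ?_, hF.trans ?_⟩
  · have := hFcov hθ
    simp only [Set.mem_iUnion, exists_prop] at this
    exact this
  · have h1 : δ ^ (-t) ≤ δ ^ (-s) :=
      Real.rpow_le_rpow_of_exponent_ge hδ (hδ'.trans_le (min_le_right _ _)).le (by linarith)
    have h2 : C ≤ max C 1 := le_max_left _ _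
    gcongr

/-- The exponent d itself need not be admissible for coverings. By continuity, the ε in g pays for a
slightly larger s. -/
lemma exists_exponent {d ε : ℝ} (hd : d < 1) (hε : 0 < ε) :
    ∃ s, d < s ∧ s < 1 ∧ 2 / (1 - s) ^ 2 ≤ 2 / (1 - d) ^ 2 + ε := by
  have hcont : ContinuousAt (fun s : ℝ => 2 / (1 - s) ^ 2) d := by
    refine ContinuousAt.div (by fun_prop) (by fun_prop) ?_
    have : 0 < 1 - d := by linarith
    positivity
  have h1 : ∀ᶠ s in nhds d, 2 / (1 - s) ^ 2 < 2 / (1 - d) ^ 2 + ε :=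
    hcont.eventually_lt continuousAt_const (by linarith)
  have h2 : ∀ᶠ s in nhdsWithin d (Set.Ioi d), d < s ∧ s < 1 := Ioo_mem_nhdsGT hd
  obtain ⟨s, hs1, hs2⟩ := ((h1.filter_mono nhdsWithin_le_nhds).and h2).exists
  exact ⟨s, hs2.1, hs2.2, hs1.le⟩

theorem exists_isGoodAngle_of_upperMinkowskiDim {Ω : Set ℝ} {d ε : ℝ}
    (hΩ : Ω ⊆ Set.Icc 0 (Real.pi / 2)) (hdim : upperMinkowskiDim Ω = d) (hd0 : 0 ≤ d)
    (hd : d < 1) (hε : 0 < ε) :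
    ∃ α ∈ Set.Icc 0 (Real.pi / 2),
      IsGoodAngle Ω (fun q => (q : ℝ) ^ (-2 / (1 - d) ^ 2 - ε)) α := by
  obtain ⟨s, hds, hs1, hs⟩ := exists_exponent hd hε
  obtain ⟨C, hC, δ₀, hδ₀, hδ₀1, hcov⟩ := exists_coveredBy_of_upperMinkowskiDim_lt hΩ
    (hdim.trans_lt hds)
  have h1s : 0 < 1 - s := by linarith
  set e : ℝ := 1 / (1 - s) with he
  have he0 : 0 < e := by positivity
  have he1 : 1 ≤ e := by rw [he, le_div_iff₀ h1s]; linarith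
  set K : ℝ := 12 * (2 * C + 3) with hK
  have hK1 : 1 ≤ K := by rw [hK]; linarith
  have hK0 : 0 < K := by linarith
  -- The solution of K φ^(1-s) = L, since δ^(-s) cells of length δ = φ(L) have total length δ^(1-s).
  set φ : ℝ → ℝ := fun L => (L / K) ^ e with hφ
  have hφle : ∀ L, 0 < L → L ≤ 1 → φ L ≤ L := by
    intro L h1 h2
    have h3 : L / K ≤ L := div_le_self h1.le hK1
    calc (L / K) ^ e ≤ L ^ e := by gcongr
      _ ≤ L ^ (1 : ℝ) := Real.rpow_le_rpow_of_exponent_ge h1 h2 he1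
      _ = L := Real.rpow_one L
  -- Half of δ₀, because coverings are available only for δ strictly below δ₀.
  refine exists_isGoodAngle hΩ (φ := φ) (L₀ := δ₀ / 2) (by positivity) ?_ ?_ ?_ ?_
  · intro L h1 _
    simp only [hφ]; positivity
  · intro L L' h1 h2 _
    simp only [hφ]; gcongr
  · intro L h1 h2
    have h3 : 0 < φ L := by simp only [hφ]; positivity
    have h4 : φ L ≤ L := hφle L h1 (by linarith)
    obtain ⟨F, hF, hFc⟩ := hcov (φ L) h3 (by linarith)
    obtain ⟨F', hF', hFc'⟩ := hF.enlarge h3.le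
    refine ⟨F', hF', ?_⟩
    have h5 : 1 ≤ φ L ^ (-s) := Real.one_le_rpow_of_pos_of_le_one_of_nonpos h3
      (by linarith) (by linarith)
    have h6 : (F'.card : ℝ) + 1 ≤ (2 * C + 3) * φ L ^ (-s) := by linarith
    calc 12 * ((F'.card : ℝ) + 1) * φ L ≤ 12 * ((2 * C + 3) * φ L ^ (-s)) * φ L := by gcongr
      _ = K * φ L ^ (1 - s) := by
        rw [sub_eq_neg_add, Real.rpow_add h3, Real.rpow_one, hK]; ring
      _ = L := by
        simp only [hφ]
        rw [← Real.rpow_mul (by positivity), he, one_div_mul_cancel h1s.ne', Real.rpow_one,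
          mul_div_cancel₀ _ hK0.ne']
  · intro c₀ hc₀ _
    refine ⟨φ (φ c₀), by simp only [hφ]; positivity, fun q hq => ?_⟩
    have hq' : (1 : ℝ) ≤ q := by exact_mod_cast hq
    have hq0 : (0 : ℝ) ≤ q := by linarith
    have hscale : φ (φ (c₀ / q ^ 2)) = φ (φ c₀) * (q : ℝ) ^ (-(2 * e ^ 2)) := by
      have h1 : φ (c₀ / q ^ 2) = φ c₀ * (q : ℝ) ^ (-(2 * e)) := by
        simp only [hφ]
        rw [div_right_comm, Real.div_rpow (by positivity) (by positivity), ← Real.rpow_natCast,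
          ← Real.rpow_mul hq0, Real.rpow_neg hq0, div_eq_mul_inv]
        norm_num
      rw [h1]
      simp only [hφ]
      rw [mul_div_right_comm, Real.mul_rpow (by positivity) (by positivity), ← Real.rpow_mul hq0]
      congr 2; ring
    rw [hscale]
    have h2 : 2 * e ^ 2 = 2 / (1 - s) ^ 2 := by rw [he]; field_simp
    refine mul_le_mul_of_nonneg_left (Real.rpow_le_rpow_of_exponent_le hq' ?_)
      (by simp only [hφ]; positivity)
    rw [h2, neg_div]
    linarith

end DirDisc

open DirDisc
theorem lemma4p1 :
    -- lacunary sequences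
    (∀ ω : ℕ → ℝ, IsLacunarySeq ω → Set.range ω ⊆ Set.Icc 0 (Real.pi / 2) →
      (∃ α ∈ Set.Icc 0 (Real.pi / 2),
        IsGoodAngle (Set.range ω) (fun q => 1 / ((q : ℝ) ^ 2 * clog q ^ 2)) α) ∧
      ∀ α : ℝ, IsGoodAngle (Set.range ω) (fun q => 1 / ((q : ℝ) ^ 2 * clog q ^ 2)) α →
        DiscBound (Set.range ω) α (fun N => clog N ^ 3)) ∧
    -- lacunary sets of order M
    (∀ (M : ℕ) (Ω : Set ℝ), 1 ≤ M → IsLacunaryOfOrder M Ω → Ω ⊆ Set.Icc 0 (Real.pi / 2) →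
      (∃ α ∈ Set.Icc 0 (Real.pi / 2),
        IsGoodAngle Ω (fun q => 1 / ((q : ℝ) ^ 2 * clog q ^ (2 * M))) α) ∧
      ∀ α : ℝ, IsGoodAngle Ω (fun q => 1 / ((q : ℝ) ^ 2 * clog q ^ (2 * M))) α →
        DiscBound Ω α (fun N => clog N ^ (2 * M + 1))) ∧
    -- sets of upper Minkowski dimension d
    (∀ (d : ℝ) (Ω : Set ℝ), 0 ≤ d → d < 1 → Ω ⊆ Set.Icc 0 (Real.pi / 2) →
      upperMinkowskiDim Ω = d → ∀ τ : ℝ, τ = 2 / (1 - d) ^ 2 - 2 → ∀ ε : ℝ, 0 < ε →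
      (∃ α ∈ Set.Icc 0 (Real.pi / 2),
        IsGoodAngle Ω (fun q => (q : ℝ) ^ (-2 / (1 - d) ^ 2 - ε)) α) ∧
      ∀ α : ℝ, IsGoodAngle Ω (fun q => (q : ℝ) ^ (-2 / (1 - d) ^ 2 - ε)) α →
        DiscBound Ω α (fun N => (N : ℝ) ^ (τ / (2 * (τ + 1)) + ε))) := by
  refine ⟨fun ω hω hΩ => ?_, fun M Ω _ hM hΩ => ?_, fun d Ω hd0 hd1 hΩ hdim τ hτ ε hε => ?_⟩
  · exact ⟨exists_isGoodAngle_of_isLacunaryOfOrder (.one _ ω hω subset_rfl) hΩ,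
      fun α hα => discBound_clog 1 hα⟩
  · exact ⟨exists_isGoodAngle_of_isLacunaryOfOrder hM hΩ, fun α hα => discBound_clog M hα⟩
  · refine ⟨exists_isGoodAngle_of_upperMinkowskiDim hΩ hdim hd0 hd1 hε, fun α hα => ?_⟩
    have hτ0 : 0 ≤ τ := by
      have h1 : 0 < (1 - d) ^ 2 := by
        have : 0 < 1 - d := by linarith
        positivity
      have h2 : 2 ≤ 2 / (1 - d) ^ 2 := by
        rw [le_div_iff₀ h1]; nlinarith
      linarith
    refine discBound_rpow hτ0 hε ?_
    rwa [show -(τ + 2 + ε) = -2 / (1 - d) ^ 2 - ε by rw [hτ]; ring]
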